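/- For $\nu\in\mathbb{R}$ let $S_\nu$ be the weighted Dirichlet space, that is, the Hilbert space of all analytic functions $f(z)=\sum_{n\ge 0}a_nz^n$ on the open unit disk $\mathbb{D}$ with $\|f\|_\nu^2=\sum_{n\ge 0}|a_n|^2(n+1)^{2\nu}<\infty$. A bounded linear operator $T$ on a Banach space $X$ is called recurrent if for every nonempty open set $U\subset X$ there is an integer $k\ge 1$ with $U\cap T^{-k}(U)\neq\emptyset$. An automorphism of $\mathbb{D}$ is a linear fractional map that maps $\mathbb{D}$ bijectively onto itself; it is called parabolic if it has exactly one fixed point on the Riemann sphere and this point lies on the unit circle, and hyperbolic if it has exactly two fixed points on the Riemann sphere and both lie on the unit circle. Theorem. Let $\phi$ be a parabolic or a hyperbolic automorphism of $\mathbb{D}$ and let $\nu\in\mathbb{R}$. Then the composition operator $C_\phi f=f\circ\phi$ is a well-defined bounded operator on $S_\nu$, and $C_\phi$ is recurrent on $S_\nu$ if and only if $\nu<\frac12$. -/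

import Mathlib

open scoped Complex.UnitDisc ComplexConjugate

noncomputable section

namespace WeightedDirichlet

/-! ### The weighted Dirichlet spaces -/

/-- `a` is the sequence of Taylor coefficients at the origin of the function `f` on the unit disc:
`f(z) = ∑ aₙ zⁿ` for every `z` in the disc. -/
def IsTaylor (a : ℕ → ℂ) (f : 𝔻 → ℂ) : Prop :=
  ∀ z : 𝔻, HasSum (fun n => a n * (z : ℂ) ^ n) (f z)

theorem IsTaylor.unique {a b : ℕ → ℂ} {f : 𝔻 → ℂ} (ha : IsTaylor a f) (hb : IsTaylor b f) :
    a = b := by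
  have key : ∀ c : ℕ → ℂ, IsTaylor c f →
      HasFPowerSeriesAt (fun z : ℂ => if h : ‖z‖ < 1 then f (Complex.UnitDisc.mk z h) else 0)
        (FormalMultilinearSeries.ofScalars ℂ c) 0 := by
    intro c hc
    rw [hasFPowerSeriesAt_iff]
    filter_upwards [Metric.ball_mem_nhds (0 : ℂ) one_pos] with z hz
    have hz' : ‖z‖ < 1 := by simpa using hz
    have := hc (Complex.UnitDisc.mk z hz')
    simpa [hz', FormalMultilinearSeries.coeff_ofScalars, mul_comm] using this
  have h := (key a ha).eq_formalMultilinearSeries (key b hb)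
  funext n
  have := congrArg (fun p : FormalMultilinearSeries ℂ ℂ ℂ => p.coeff n) h
  simpa [FormalMultilinearSeries.coeff_ofScalars] using this

/-- The squared weight `βₙ² = ((n + 1) ^ ν) ^ 2`. -/
def sqWeight (ν : ℝ) (n : ℕ) : ℝ := (((n : ℝ) + 1) ^ ν) ^ 2

theorem sqWeight_pos (ν : ℝ) (n : ℕ) : 0 < sqWeight ν n := by
  unfold sqWeight; positivity

/-- The functions `f(z) = ∑ aₙ zⁿ` analytic on the disc with `∑ |aₙ|² (n + 1) ^ (2ν) < ∞`. -/
def dirichletSubmodule (ν : ℝ) : Submodule ℂ (𝔻 → ℂ) where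
  carrier := {f | ∃ a : ℕ → ℂ, IsTaylor a f ∧ Summable fun n => ‖a n‖ ^ 2 * sqWeight ν n}
  zero_mem' := ⟨0, fun z => by simp, by simp⟩
  add_mem' := by
    rintro f g ⟨a, ha, ha'⟩ ⟨b, hb, hb'⟩
    refine ⟨a + b, fun z => by simpa [add_mul] using (ha z).add (hb z), ?_⟩
    refine Summable.of_nonneg_of_le (fun n => ?_) (fun n => ?_) ((ha'.add hb').mul_left 2)
    · have := sqWeight_pos ν n; positivity
    · have hw := (sqWeight_pos ν n).le
      have h1 : ‖a n + b n‖ ^ 2 ≤ 2 * (‖a n‖ ^ 2 + ‖b n‖ ^ 2) := by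
        have := norm_add_le (a n) (b n)
        nlinarith [norm_nonneg (a n + b n), sq_nonneg (‖a n‖ - ‖b n‖)]
      calc ‖(a + b) n‖ ^ 2 * sqWeight ν n
          ≤ (2 * (‖a n‖ ^ 2 + ‖b n‖ ^ 2)) * sqWeight ν n := mul_le_mul_of_nonneg_right h1 hw
        _ = 2 * (‖a n‖ ^ 2 * sqWeight ν n + ‖b n‖ ^ 2 * sqWeight ν n) := by ring
  smul_mem' := by
    rintro c f ⟨a, ha, ha'⟩
    refine ⟨c • a, fun z => by simpa [mul_assoc] using (ha z).mul_left c, ?_⟩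
    simpa [mul_pow, mul_assoc] using ha'.mul_left (‖c‖ ^ 2)

/-- The weighted Dirichlet space `S_ν`. It is a separate type, so that it carries the topology of
its norm and not that of pointwise convergence. -/
def S (ν : ℝ) : Type := dirichletSubmodule ν

namespace S

variable {ν : ℝ}

instance : AddCommGroup (S ν) := inferInstanceAs (AddCommGroup (dirichletSubmodule ν))

instance : Module ℂ (S ν) := inferInstanceAs (Module ℂ (dirichletSubmodule ν))

instance : CoeFun (S ν) (fun _ => 𝔻 → ℂ) := ⟨fun f => f.1⟩

theorem coe_add (f g : S ν) (z : 𝔻) : (f + g) z = f z + g z := rfl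

theorem coe_smul (c : ℂ) (f : S ν) (z : 𝔻) : (c • f) z = c * f z := rfl

/-- The Taylor coefficients of an element of `S_ν`. -/
def coeff (f : S ν) : ℕ → ℂ := f.2.choose

theorem isTaylor_coeff (f : S ν) : IsTaylor f.coeff f := f.2.choose_spec.1

theorem summable_coeff (f : S ν) : Summable fun n => ‖f.coeff n‖ ^ 2 * sqWeight ν n :=
  f.2.choose_spec.2

theorem coeff_add (f g : S ν) (n : ℕ) : (f + g).coeff n = f.coeff n + g.coeff n := by
  have : IsTaylor (fun n => f.coeff n + g.coeff n) (f + g : S ν) := fun z => by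
    simpa [add_mul, coe_add] using (f.isTaylor_coeff z).add (g.isTaylor_coeff z)
  exact congrFun ((f + g).isTaylor_coeff.unique this) n

theorem coeff_smul (c : ℂ) (f : S ν) (n : ℕ) : (c • f).coeff n = c * f.coeff n := by
  have : IsTaylor (fun n => c * f.coeff n) (c • f : S ν) := fun z => by
    simpa [mul_assoc, coe_smul] using (f.isTaylor_coeff z).mul_left c
  exact congrFun ((c • f).isTaylor_coeff.unique this) n

theorem summable_inner (f g : S ν) :
    Summable fun n => conj (f.coeff n) * g.coeff n * (sqWeight ν n : ℂ) := by
  refine Summable.of_norm_bounded (f.summable_coeff.add g.summable_coeff) fun n => ?_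
  have hw := (sqWeight_pos ν n).le
  rw [norm_mul, norm_mul, RCLike.norm_conj, Complex.norm_real, Real.norm_of_nonneg hw, ← add_mul]
  refine mul_le_mul_of_nonneg_right ?_ hw
  nlinarith [sq_nonneg (‖f.coeff n‖ - ‖g.coeff n‖), sq_nonneg ‖f.coeff n‖, sq_nonneg ‖g.coeff n‖]

/-- The inner product `⟨f, g⟩ = ∑ conj(aₙ) bₙ βₙ²` of `S_ν`, conjugate linear in the first
variable. -/
@[reducible]
def core (ν : ℝ) : InnerProductSpace.Core ℂ (S ν) where
  inner f g := ∑' n, conj (f.coeff n) * g.coeff n * (sqWeight ν n : ℂ)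
  conj_inner_symm f g := by
    rw [Complex.conj_tsum]
    refine tsum_congr fun n => ?_
    simp [mul_comm]
  re_inner_nonneg f := by
    have : ∀ n, conj (f.coeff n) * f.coeff n * (sqWeight ν n : ℂ)
        = ((‖f.coeff n‖ ^ 2 * sqWeight ν n : ℝ) : ℂ) := fun n => by
      rw [Complex.conj_mul']; push_cast; rfl
    simp_rw [this]
    rw [← Complex.ofReal_tsum]
    exact tsum_nonneg fun n => mul_nonneg (sq_nonneg _) (sqWeight_pos ν n).le
  add_left f g h := by
    rw [← (summable_inner f h).tsum_add (summable_inner g h)]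
    refine tsum_congr fun n => ?_
    rw [coeff_add, map_add]; ring
  smul_left f g r := by
    rw [← tsum_mul_left]
    refine tsum_congr fun n => ?_
    rw [coeff_smul, map_mul]; ring
  definite f hf := by
    have : ∀ n, conj (f.coeff n) * f.coeff n * (sqWeight ν n : ℂ)
        = ((‖f.coeff n‖ ^ 2 * sqWeight ν n : ℝ) : ℂ) := fun n => by
      rw [Complex.conj_mul']; push_cast; rfl
    simp_rw [this] at hf
    rw [← Complex.ofReal_tsum, Complex.ofReal_eq_zero] at hf
    have h0 := (hasSum_zero_iff_of_nonneg
      (fun n => mul_nonneg (sq_nonneg _) (sqWeight_pos ν n).le)).1 (hf ▸ f.summable_coeff.hasSum)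
    have hc : ∀ n, f.coeff n = 0 := fun n => by
      simpa [(sqWeight_pos ν n).ne'] using congrFun h0 n
    refine Subtype.ext (funext fun z => ?_)
    have := f.isTaylor_coeff z
    simp only [hc, zero_mul] at this
    exact this.unique hasSum_zero

instance : NormedAddCommGroup (S ν) := (core ν).toNormedAddCommGroup

instance : InnerProductSpace ℂ (S ν) := InnerProductSpace.ofCore (core ν).toCore

theorem norm_sq_eq (f : S ν) : ‖f‖ ^ 2 = ∑' n, ‖f.coeff n‖ ^ 2 * sqWeight ν n := by
  have : ∀ n, conj (f.coeff n) * f.coeff n * (sqWeight ν n : ℂ)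
      = ((‖f.coeff n‖ ^ 2 * sqWeight ν n : ℝ) : ℂ) := fun n => by
    rw [Complex.conj_mul']; push_cast; rfl
  have h : inner ℂ f f = ∑' n, conj (f.coeff n) * f.coeff n * (sqWeight ν n : ℂ) := rfl
  simp_rw [this] at h
  rw [← inner_self_eq_norm_sq (𝕜 := ℂ), h, ← Complex.ofReal_tsum]
  rfl

end S

/-! ### Recurrence and composition operators -/

/-- A bounded operator is recurrent if every nonempty open set meets its preimage under some
iterate `T ^ k`, `k ≥ 1`. -/
def IsRecurrent {X : Type*} [NormedAddCommGroup X] [NormedSpace ℂ X] (T : X →L[ℂ] X) : Prop :=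
  ∀ U : Set X, IsOpen U → U.Nonempty → ∃ k : ℕ, 1 ≤ k ∧ (U ∩ (⇑(T ^ k)) ⁻¹' U).Nonempty

/-- `T` is the composition operator `C_φ f = f ∘ φ` on `S_ν`. -/
def IsCompositionOperator {ν : ℝ} (φ : 𝔻 → 𝔻) (T : S ν →L[ℂ] S ν) : Prop :=
  ∀ (f : S ν) (z : 𝔻), (T f) z = f (φ z)

/-! ### Automorphisms of the disc

The group `GL₂(ℂ)` acts on the Riemann sphere `OnePoint ℂ` by linear fractional maps. -/

/-- `φ` maps the disc bijectively onto itself and is the restriction of the linear fractional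
map `w ↦ g • w` of the Riemann sphere. -/
def IsAutomorphismBy (g : GL (Fin 2) ℂ) (φ : 𝔻 → 𝔻) : Prop :=
  Function.Bijective φ ∧ ∀ z : 𝔻, g • ((z : ℂ) : OnePoint ℂ) = ((φ z : ℂ) : OnePoint ℂ)

/-- A parabolic automorphism: it has exactly one fixed point on the Riemann sphere, and this point
is on the unit circle. -/
def IsParabolicAutomorphism (φ : 𝔻 → 𝔻) : Prop :=
  ∃ g : GL (Fin 2) ℂ, IsAutomorphismBy g φ ∧
    ∃ p : ℂ, ‖p‖ = 1 ∧ {w : OnePoint ℂ | g • w = w} = {(p : OnePoint ℂ)}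

/-- A hyperbolic automorphism: it has exactly two fixed points on the Riemann sphere, and both are
on the unit circle. -/
def IsHyperbolicAutomorphism (φ : 𝔻 → 𝔻) : Prop :=
  ∃ g : GL (Fin 2) ℂ, IsAutomorphismBy g φ ∧
    ∃ p q : ℂ, ‖p‖ = 1 ∧ ‖q‖ = 1 ∧ p ≠ q ∧
      {w : OnePoint ℂ | g • w = w} = {(p : OnePoint ℂ), (q : OnePoint ℂ)}

end WeightedDirichlet

end

noncomputable section

namespace WeightedDirichlet

open Filter Topology

/-! Boundedness. Write `φ(z) = l (z - a) / (1 - ā z)` and join the rotation `z ↦ l z` to `φ` by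
replacing `a` with `t a`, `0 ≤ t ≤ 1`. The functions `F_t(z) = f(l (z - t a) / (1 - t ā z))` satisfy
`∂_t F = (ā z² - a) (1 - t² |a|²)⁻¹ ∂_z F`. In the derivative of `‖F_t‖²` the coefficient of `Re (a
c̄_n c_{n+1})` is, up to a common factor, `n β_{n+1}² - (n + 1) β_n²`; the leading parts cancel,
leaving `O(β_n²)`, and Grönwall gives `‖f ∘ φ‖ ≤ const ‖f‖`. This is done on the span of the kernels
`1 / (1 - w z)`, whose coefficients are explicit, and extended by density (`IsMoebius.exists_bound`,
`IsMoebius.exists_compositionOperator`).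

Dynamics. Parabolic and hyperbolic automorphisms are conjugate to a translation or a dilation, so
all orbits in the disc converge to one point `p` of the circle (`exists_tendsto_iterate`).

Recurrence for `ν < 1/2`. The functions `1 / (1 - w z) - 1 / (1 - w p)`, which vanish at `p`, span a
dense subspace, and the iterates of `C_φ` tend to zero on it: the constant terms converge to the
value at `p`, and for the other coefficients the Dirichlet energy stays bounded while the weight is
`o(n)`. The inverse of `φ` is of the same kind, so Kitai's criterion applies
(`isRecurrent_of_dense`).

Failure for `ν ≥ 1/2`. Here `|f'(b)| ≤ ‖f‖ / (1 - |b|²)`, while `|φ'(0)| = 1 - |φ(0)|²` for an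
automorphism, so `|(f ∘ φ^k)'(0)| ≤ ‖f‖` for every `k`. For the identity function this derivative
has modulus `1 - |φ^k(0)|²`, which stays away from `1`; hence no function near the identity returns
near it (`not_isRecurrent_of_le`). -/

/-! ### Growth of the weights and summability. -/

theorem sqWeight_eq (ν : ℝ) (n : ℕ) : sqWeight ν n = ((n : ℝ) + 1) ^ (2 * ν) := by
  rw [sqWeight, ← Real.rpow_natCast, ← Real.rpow_mul (by positivity)]
  congr 1
  push_cast
  ring

theorem sqWeight_neg (ν : ℝ) (n : ℕ) : sqWeight (-ν) n = (sqWeight ν n)⁻¹ := by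
  rw [sqWeight_eq, sqWeight_eq, mul_neg, Real.rpow_neg (by positivity)]

theorem summable_add_one_pow_mul_geometric (k : ℕ) {r : ℝ} (hr0 : 0 ≤ r) (hr1 : r < 1) :
    Summable fun n : ℕ => ((n : ℝ) + 1) ^ k * r ^ n := by
  -- The ratio `(1 + r) / 2` lies between `r` and `1` and is nonzero even for `r = 0`, so it can be
  -- divided out after the index shift.
  have h : Summable fun n : ℕ => (n : ℝ) ^ k * ((1 + r) / 2) ^ n :=
    summable_pow_mul_geometric_of_norm_lt_one k (by
      rw [Real.norm_of_nonneg (by linarith)]; linarith)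
  have h' := ((summable_nat_add_iff 1).2 h).mul_left ((1 + r) / 2)⁻¹
  refine Summable.of_nonneg_of_le (fun n => by positivity) (fun n => ?_) h'
  have hpos : 0 < (1 + r) / 2 := by linarith
  have : r ^ n ≤ ((1 + r) / 2) ^ n := pow_le_pow_left₀ hr0 (by linarith) n
  push_cast
  rw [pow_succ, show ((1 + r) / 2)⁻¹ * (((n : ℝ) + 1) ^ k * (((1 + r) / 2) ^ n * ((1 + r) / 2)))
    = ((n : ℝ) + 1) ^ k * ((1 + r) / 2) ^ n by field_simp]
  gcongr

theorem sqWeight_le_pow (ν : ℝ) (n : ℕ) :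
    sqWeight ν n ≤ ((n : ℝ) + 1) ^ ⌈2 * ν⌉₊ := by
  rw [sqWeight_eq, ← Real.rpow_natCast]
  exact Real.rpow_le_rpow_of_exponent_le (by linarith [(Nat.cast_nonneg n : (0 : ℝ) ≤ n)])
    (Nat.le_ceil _)

theorem summable_geometric_mul_sqWeight (ν : ℝ) {r : ℝ} (hr0 : 0 ≤ r) (hr1 : r < 1) :
    Summable fun n : ℕ => r ^ n * sqWeight ν n := by
  refine Summable.of_nonneg_of_le (fun n => ?_) (fun n => ?_)
    (summable_add_one_pow_mul_geometric ⌈2 * ν⌉₊ hr0 hr1)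
  · have := sqWeight_pos ν n; positivity
  · rw [mul_comm]
    gcongr
    exact sqWeight_le_pow ν n

theorem summable_sq_norm_of_geometric (ν : ℝ) {a : ℕ → ℂ} {r C : ℝ} (hr0 : 0 ≤ r) (hr1 : r < 1)
    (ha : ∀ n, ‖a n‖ ≤ C * r ^ n) : Summable fun n => ‖a n‖ ^ 2 * sqWeight ν n := by
  refine Summable.of_nonneg_of_le (fun n => ?_) (fun n => ?_)
    ((summable_geometric_mul_sqWeight ν (sq_nonneg r) (by nlinarith)).mul_left (C ^ 2))
  · have := sqWeight_pos ν n; positivity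
  · have h2 : ‖a n‖ ^ 2 ≤ (C * r ^ n) ^ 2 := pow_le_pow_left₀ (norm_nonneg _) (ha n) 2
    calc ‖a n‖ ^ 2 * sqWeight ν n ≤ (C * r ^ n) ^ 2 * sqWeight ν n :=
          mul_le_mul_of_nonneg_right h2 (sqWeight_pos ν n).le
      _ = C ^ 2 * ((r ^ 2) ^ n * sqWeight ν n) := by ring

/-- The inequality `x y ≤ x² β² + y² β⁻²` separates the coefficients from the powers of `z`; the
second series has the weight of exponent `-ν`. -/
theorem summable_mul_pow {ν : ℝ} {a : ℕ → ℂ} (ha : Summable fun n => ‖a n‖ ^ 2 * sqWeight ν n)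
    {z : ℂ} (hz : ‖z‖ < 1) : Summable fun n => a n * z ^ n := by
  refine Summable.of_norm_bounded (ha.add (summable_geometric_mul_sqWeight (-ν)
    (sq_nonneg ‖z‖) (by nlinarith [norm_nonneg z]))) fun n => ?_
  have hw := sqWeight_pos ν n
  rw [norm_mul, norm_pow, sqWeight_neg, ← pow_mul, mul_comm 2 n, pow_mul]
  set x := ‖a n‖
  set y := ‖z‖ ^ n
  have hx : 0 ≤ x := norm_nonneg _
  have hy : 0 ≤ y := by positivity
  have h : x * y * sqWeight ν n ≤ (x ^ 2 * sqWeight ν n + y ^ 2 * (sqWeight ν n)⁻¹)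
      * sqWeight ν n := by
    rw [add_mul, mul_assoc (y ^ 2), inv_mul_cancel₀ hw.ne']
    nlinarith [sq_nonneg (x * sqWeight ν n - y), mul_nonneg hx hy, mul_nonneg hx hw.le,
      mul_nonneg (mul_nonneg hx hw.le) hy]
  exact le_of_mul_le_mul_right h hw

/-! ### Completeness, point evaluations and dense families of kernels. -/

namespace S

variable {ν : ℝ}

/-- The element of `S_ν` with prescribed Taylor coefficients. -/
def ofCoeff (a : ℕ → ℂ) (ha : Summable fun n => ‖a n‖ ^ 2 * sqWeight ν n) : S ν :=
  ⟨fun z => ∑' n, a n * (z : ℂ) ^ n, a, fun z => (summable_mul_pow ha z.norm_lt_one).hasSum, ha⟩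

theorem ofCoeff_apply (a : ℕ → ℂ) (ha : Summable fun n => ‖a n‖ ^ 2 * sqWeight ν n) (z : 𝔻) :
    ofCoeff a ha z = ∑' n, a n * (z : ℂ) ^ n := rfl

theorem isTaylor_ofCoeff (a : ℕ → ℂ) (ha : Summable fun n => ‖a n‖ ^ 2 * sqWeight ν n) :
    IsTaylor a (ofCoeff a ha) :=
  fun z => (summable_mul_pow ha z.norm_lt_one).hasSum

theorem coeff_eq_of_isTaylor {f : S ν} {a : ℕ → ℂ} (h : IsTaylor a f) : f.coeff = a :=
  f.isTaylor_coeff.unique h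

theorem coeff_ofCoeff (a : ℕ → ℂ) (ha : Summable fun n => ‖a n‖ ^ 2 * sqWeight ν n) :
    (ofCoeff a ha).coeff = a :=
  coeff_eq_of_isTaylor (isTaylor_ofCoeff a ha)

theorem ext_apply {f g : S ν} (h : ∀ z, f z = g z) : f = g := Subtype.ext (funext h)

theorem ext_coeff {f g : S ν} (h : f.coeff = g.coeff) : f = g :=
  ext_apply fun z => (f.isTaylor_coeff z).unique (h ▸ g.isTaylor_coeff z)

theorem coeff_zero (n : ℕ) : (0 : S ν).coeff n = 0 := by
  simpa using coeff_smul 0 (0 : S ν) n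

theorem coeff_sub (f g : S ν) (n : ℕ) : (f - g).coeff n = f.coeff n - g.coeff n := by
  have := coeff_add f ((-1 : ℂ) • g) n
  rw [coeff_smul, neg_one_smul, ← sub_eq_add_neg] at this
  rw [this]; ring

theorem inner_eq (f g : S ν) :
    inner ℂ f g = ∑' n, conj (f.coeff n) * g.coeff n * (sqWeight ν n : ℂ) := rfl

theorem hasSum_norm_sq (f : S ν) : HasSum (fun n => ‖f.coeff n‖ ^ 2 * sqWeight ν n) (‖f‖ ^ 2) := by
  rw [norm_sq_eq]; exact f.summable_coeff.hasSum

theorem sum_le_norm_sq (f : S ν) (s : Finset ℕ) :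
    ∑ n ∈ s, ‖f.coeff n‖ ^ 2 * sqWeight ν n ≤ ‖f‖ ^ 2 :=
  sum_le_hasSum s (fun n _ => mul_nonneg (sq_nonneg _) (sqWeight_pos ν n).le) f.hasSum_norm_sq

theorem norm_sq_le_of_sum_le {f : S ν} {B : ℝ}
    (h : ∀ M, ∑ n ∈ Finset.range (M + 1), ‖f.coeff n‖ ^ 2 * sqWeight ν n ≤ B) : ‖f‖ ^ 2 ≤ B :=
  le_of_tendsto' (f.hasSum_norm_sq.tendsto_sum_nat.comp (tendsto_add_atTop_nat 1)) h

/-- The weighted coefficient sequence of an element of `S_ν`, as an element of `ℓ²`. -/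
def toL2 (f : S ν) : lp (fun _ : ℕ => ℂ) 2 :=
  ⟨fun n => f.coeff n * ((((n : ℝ) + 1) ^ ν : ℝ) : ℂ), by
    refine memℓp_gen ?_
    refine f.summable_coeff.congr fun n => ?_
    have : (0 : ℝ) ≤ ((n : ℝ) + 1) ^ ν := by positivity
    simp [sqWeight, mul_pow, abs_of_nonneg this]⟩

/-- Together with surjectivity this transfers completeness from `ℓ²`, which the extension of
operators and the orthogonality criterion for density require. -/
theorem isometry_toL2 : Isometry (toL2 : S ν → lp (fun _ : ℕ => ℂ) 2) := by
  refine Isometry.of_dist_eq fun f g => ?_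
  rw [dist_eq_norm, dist_eq_norm]
  refine (pow_left_inj₀ (norm_nonneg _) (norm_nonneg _) two_ne_zero).1 ?_
  have h := lp.norm_rpow_eq_tsum (p := 2) (by simp) (toL2 f - toL2 g)
  simp only [ENNReal.toReal_ofNat, Real.rpow_two] at h
  rw [h, norm_sq_eq]
  refine tsum_congr fun n => ?_
  have h0 : (0 : ℝ) ≤ ((n : ℝ) + 1) ^ ν := by positivity
  have h1 : (toL2 f - toL2 g) n = (f - g).coeff n * ((((n : ℝ) + 1) ^ ν : ℝ) : ℂ) := by
    rw [coeff_sub, sub_mul]; rfl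
  rw [h1, norm_mul, mul_pow, Complex.norm_real, Real.norm_of_nonneg h0, sqWeight]

theorem surjective_toL2 : Function.Surjective (toL2 : S ν → lp (fun _ : ℕ => ℂ) 2) := by
  intro x
  have hx : Summable fun n => ‖x n‖ ^ 2 := by
    have := (lp.memℓp x).summable (by simp)
    simpa using this
  have hpos : ∀ n : ℕ, (0 : ℝ) < ((n : ℝ) + 1) ^ ν := fun n => by positivity
  have hs : Summable fun n => ‖x n * ((((n : ℝ) + 1) ^ ν : ℝ) : ℂ)⁻¹‖ ^ 2 * sqWeight ν n := by
    refine hx.congr fun n => ?_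
    have := (hpos n).ne'
    rw [norm_mul, norm_inv, Complex.norm_real, Real.norm_of_nonneg (hpos n).le, sqWeight]
    field_simp
  refine ⟨ofCoeff _ hs, ?_⟩
  ext n
  have : ((((n : ℝ) + 1) ^ ν : ℝ) : ℂ) ≠ 0 := Complex.ofReal_ne_zero.2 (hpos n).ne'
  change (ofCoeff _ hs).coeff n * ((((n : ℝ) + 1) ^ ν : ℝ) : ℂ) = x n
  rw [coeff_ofCoeff]
  field_simp

instance : CompleteSpace (S ν) :=
  (isometry_toL2.isUniformInducing.completeSpace_congr surjective_toL2).2 inferInstance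

/-- Evaluation at `z` is the inner product with the reproducing kernel, whose coefficients are `conj
(zⁿ) / βₙ²`. -/
theorem continuous_eval (z : 𝔻) : Continuous fun f : S ν => f z := by
  have hs : Summable fun n => ‖conj ((z : ℂ) ^ n) * ((sqWeight ν n)⁻¹ : ℝ)‖ ^ 2 * sqWeight ν n := by
    refine (summable_geometric_mul_sqWeight (-ν) (sq_nonneg ‖(z : ℂ)‖) z.sq_norm_lt_one).congr
      fun n => ?_
    have := (sqWeight_pos ν n).ne'
    rw [norm_mul, RCLike.norm_conj, Complex.norm_real, norm_pow, mul_pow, norm_inv,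
      Real.norm_of_nonneg (sqWeight_pos ν n).le, sqWeight_neg]
    field_simp
    ring
  have h : ∀ f : S ν, f z = inner ℂ (ofCoeff _ hs) f := fun f => by
    rw [inner_eq, ← (f.isTaylor_coeff z).tsum_eq]
    refine tsum_congr fun n => ?_
    have : ((sqWeight ν n : ℝ) : ℂ) ≠ 0 := Complex.ofReal_ne_zero.2 (sqWeight_pos ν n).ne'
    rw [coeff_ofCoeff, map_mul, Complex.conj_conj, Complex.conj_ofReal]
    push_cast
    field_simp
  simp_rw [h]
  fun_prop

/-- The function `z ↦ 1 / (1 - w z)`. -/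
def kernel (ν : ℝ) (w : 𝔻) : S ν :=
  ofCoeff (fun n => (w : ℂ) ^ n)
    (summable_sq_norm_of_geometric ν (C := 1) (norm_nonneg _) w.norm_lt_one (by simp))

theorem coeff_kernel (w : 𝔻) (n : ℕ) : (kernel ν w).coeff n = (w : ℂ) ^ n := by
  rw [kernel, coeff_ofCoeff]

theorem kernel_apply (w z : 𝔻) : kernel ν w z = (1 - (w : ℂ) * z)⁻¹ := by
  rw [kernel, ofCoeff_apply]
  simp_rw [← mul_pow]
  refine tsum_geometric_of_norm_lt_one ?_
  rw [norm_mul]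
  exact mul_lt_one_of_nonneg_of_lt_one_left (norm_nonneg _) w.norm_lt_one z.norm_lt_one.le

/-- As `w` varies, the inner product is a power series in `w`. Uniqueness of Taylor coefficients
therefore turns orthogonality to kernels into conditions on each coefficient of `g`. -/
theorem isTaylor_inner_kernel (g : S ν) :
    IsTaylor (fun n => conj (g.coeff n) * (sqWeight ν n : ℂ)) fun w => inner ℂ g (kernel ν w) := by
  intro w
  have := (summable_inner g (kernel ν w)).hasSum
  simp_rw [coeff_kernel] at this
  simp_rw [inner_eq, coeff_kernel]
  convert this using 2
  ring

theorem dense_span_kernel :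
    Dense (Submodule.span ℂ (Set.range (kernel ν)) : Set (S ν)) := by
  rw [Submodule.dense_iff_topologicalClosure_eq_top, Submodule.topologicalClosure_eq_top_iff,
    Submodule.eq_bot_iff]
  intro g hg
  have h0 : ∀ w, inner ℂ g (kernel ν w) = 0 := fun w =>
    Submodule.inner_left_of_mem_orthogonal (Submodule.subset_span (Set.mem_range_self w)) hg
  have h := (isTaylor_inner_kernel g).unique (b := 0) (fun w => by
    simp [h0])
  refine ext_coeff (funext fun n => ?_)
  have := congrFun h n
  simpa [(sqWeight_pos ν n).ne', coeff_zero] using this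

/-- The function `z ↦ 1 / (1 - w z) - 1 / (1 - w p)`, which vanishes at the point `p` of the
circle. -/
def vanishingKernel (ν : ℝ) (p : ℂ) (w : 𝔻) : S ν :=
  kernel ν w - (1 - (w : ℂ) * p)⁻¹ • kernel ν 0

theorem not_summable_sqWeight {ν : ℝ} (hν : -(1 / 2) ≤ ν) : ¬ Summable (sqWeight ν) := by
  intro h
  have h2 : Summable fun n : ℕ => ((n + 1 : ℕ) : ℝ) ^ (2 * ν) :=
    h.congr fun n => by rw [sqWeight_eq]; push_cast; rfl
  have := Real.summable_nat_rpow.1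
    ((summable_nat_add_iff (f := fun n : ℕ => (n : ℝ) ^ (2 * ν)) 1).1 h2)
  linarith

/-- If `g` is orthogonal to the family, then `⟨g, k_w⟩ = c / (1 - w p)`, so `|g_n| β_n² = |c|` for
all `n`. Then `∑ |g_n|² β_n² = |c|² ∑ (n + 1)^(-2ν)`, which diverges for `ν ≤ 1/2` unless `c = 0`.
-/
theorem dense_span_vanishingKernel (hν : ν ≤ 1 / 2) {p : ℂ} (hp : ‖p‖ = 1) :
    Dense (Submodule.span ℂ (Set.range (vanishingKernel ν p)) : Set (S ν)) := by
  rw [Submodule.dense_iff_topologicalClosure_eq_top, Submodule.topologicalClosure_eq_top_iff,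
    Submodule.eq_bot_iff]
  intro g hg
  set c := inner ℂ g (kernel ν 0) with hc
  have h0 : ∀ w : 𝔻, inner ℂ g (kernel ν w) = c * (1 - (w : ℂ) * p)⁻¹ := fun w => by
    have : inner ℂ g (vanishingKernel ν p w) = 0 :=
      Submodule.inner_left_of_mem_orthogonal (Submodule.subset_span (Set.mem_range_self w)) hg
    rw [vanishingKernel, inner_sub_right, inner_smul_right, sub_eq_zero] at this
    rw [this, mul_comm]
  have h := (isTaylor_inner_kernel g).unique (b := fun n => c * p ^ n) (fun w => by
    beta_reduce
    rw [h0]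
    have : ‖(w : ℂ) * p‖ < 1 := by rw [norm_mul, hp, mul_one]; exact w.norm_lt_one
    have e : (fun n => c * p ^ n * (w : ℂ) ^ n) = fun n => c * ((w : ℂ) * p) ^ n := by
      funext n; rw [mul_pow]; ring
    rw [e]
    exact (hasSum_geometric_of_norm_lt_one this).mul_left c)
  have hn : ∀ n, ‖g.coeff n‖ * sqWeight ν n = ‖c‖ := fun n => by
    have := congrArg norm (congrFun h n)
    simpa [hp, abs_of_pos (sqWeight_pos ν n)] using this
  have hc0 : ‖c‖ = 0 := by
    by_contra hne
    refine not_summable_sqWeight (ν := -ν) (by linarith)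
      ((g.summable_coeff.mul_left (‖c‖ ^ 2)⁻¹).congr fun n => ?_)
    have := (sqWeight_pos ν n).ne'
    rw [sqWeight_neg, ← hn n] at *
    have h3 : ‖g.coeff n‖ ≠ 0 := fun h => by simp [h] at hne
    field_simp
  refine ext_coeff (funext fun n => ?_)
  have := hn n
  rw [hc0] at this
  simpa [(sqWeight_pos ν n).ne', coeff_zero] using this

end S

/-! ### Taylor coefficients of `(1 - w (z - a) / (1 - ā z))⁻¹` -/

/-- The Taylor coefficients at the origin of `z ↦ (1 - w (z - a) / (1 - ā z))⁻¹`. -/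
def moebiusCoeff (a w : ℂ) : ℕ → ℂ
  | 0 => (1 + w * a)⁻¹
  | n + 1 => w * (1 - a * conj a) * (w + conj a) ^ n / (1 + w * a) ^ (n + 2)

theorem one_add_mul_ne_zero {a w : ℂ} (ha : ‖a‖ < 1) (hw : ‖w‖ < 1) : 1 + w * a ≠ 0 := by
  intro h
  have : ‖w * a‖ = 1 := by rw [show w * a = -1 by linear_combination h]; simp
  rw [norm_mul] at this
  nlinarith [norm_nonneg a, norm_nonneg w]

theorem one_sub_conj_mul_ne_zero {a z : ℂ} (ha : ‖a‖ < 1) (hz : ‖z‖ ≤ 1) :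
    1 - conj a * z ≠ 0 := by
  intro h
  have : ‖conj a * z‖ = 1 := by rw [show conj a * z = 1 by linear_combination -h]; simp
  rw [norm_mul, RCLike.norm_conj] at this
  nlinarith [norm_nonneg a, norm_nonneg z]

theorem one_sub_norm_le_norm_one_add_mul {a w : ℂ} (ha : ‖a‖ ≤ 1) :
    1 - ‖w‖ ≤ ‖1 + w * a‖ := by
  have h := norm_sub_norm_le (1 : ℂ) (-(w * a))
  rw [norm_one, norm_neg, norm_mul, sub_neg_eq_add] at h
  nlinarith [norm_nonneg w]

/-- This is the Schwarz–Pick identity; it controls the geometric ratio `(w + ā) / (1 + w a)` of the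
coefficients. -/
theorem sq_norm_one_add_mul_sub (a w : ℂ) :
    ‖1 + w * a‖ ^ 2 - ‖w + conj a‖ ^ 2 = (1 - ‖w‖ ^ 2) * (1 - ‖a‖ ^ 2) := by
  simp only [Complex.sq_norm, Complex.normSq_apply]
  simp
  ring

theorem norm_div_sq {a w : ℂ} (ha : ‖a‖ < 1) (hw : ‖w‖ < 1) :
    ‖(w + conj a) / (1 + w * a)‖ ^ 2
      = 1 - (1 - ‖w‖ ^ 2) * (1 - ‖a‖ ^ 2) / ‖1 + w * a‖ ^ 2 := by
  have h := norm_ne_zero_iff.2 (one_add_mul_ne_zero ha hw)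
  rw [norm_div, ← sq_norm_one_add_mul_sub]
  field_simp
  ring

theorem norm_div_lt_one {a w : ℂ} (ha : ‖a‖ < 1) (hw : ‖w‖ < 1) :
    ‖(w + conj a) / (1 + w * a)‖ < 1 := by
  have h := norm_pos_iff.2 (one_add_mul_ne_zero ha hw)
  have h2 : 0 < (1 - ‖w‖ ^ 2) * (1 - ‖a‖ ^ 2) / ‖1 + w * a‖ ^ 2 :=
    div_pos (mul_pos (by nlinarith [norm_nonneg w]) (by nlinarith [norm_nonneg a])) (by positivity)
  have h3 := norm_div_sq ha hw
  exact (sq_lt_one_iff₀ (norm_nonneg _)).1 (by linarith)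

theorem hasSum_moebiusCoeff {a w z : ℂ} (ha : ‖a‖ < 1) (hw : ‖w‖ < 1) (hz : ‖z‖ < 1) :
    HasSum (fun n => moebiusCoeff a w n * z ^ n) (1 - w * ((z - a) / (1 - conj a * z)))⁻¹ := by
  have h1 := one_add_mul_ne_zero ha hw
  have h2 := one_sub_conj_mul_ne_zero ha hz.le
  set u := (w + conj a) / (1 + w * a) with hu
  have hu1 : ‖u‖ < 1 := norm_div_lt_one ha hw
  have huz : ‖u * z‖ < 1 := by
    rw [norm_mul]
    exact mul_lt_one_of_nonneg_of_lt_one_left (norm_nonneg _) hu1 hz.le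
  have h3 : 1 - u * z ≠ 0 := by
    intro h
    rw [show u * z = 1 by linear_combination -h] at huz
    simp at huz
  have h4 : (1 + w * a) - (w + conj a) * z ≠ 0 := by
    intro h
    apply h3
    rw [hu]
    field_simp
    linear_combination h
  rw [← hasSum_nat_add_iff' 1]
  have hg := (hasSum_geometric_of_norm_lt_one huz).mul_left
    (w * (1 - a * conj a) * z / (1 + w * a) ^ 2)
  have e : (fun n => moebiusCoeff a w (n + 1) * z ^ (n + 1))
      = fun n => w * (1 - a * conj a) * z / (1 + w * a) ^ 2 * (u * z) ^ n := by
    funext n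
    rw [moebiusCoeff, hu, mul_pow, div_pow]
    field_simp
    ring
  rw [e]
  have h5 : 1 - w * ((z - a) / (1 - conj a * z))
      = ((1 + w * a) - (w + conj a) * z) / (1 - conj a * z) := by
    rw [eq_div_iff h2, sub_mul, mul_assoc, div_mul_cancel₀ _ h2]
    ring
  have h6 : 1 - u * z = ((1 + w * a) - (w + conj a) * z) / (1 + w * a) := by
    rw [hu]; field_simp
  have h7 : (1 - w * ((z - a) / (1 - conj a * z)))⁻¹
      - ∑ i ∈ Finset.range 1, moebiusCoeff a w i * z ^ i
      = w * (1 - a * conj a) * z / (1 + w * a) ^ 2 * (1 - u * z)⁻¹ := by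
    rw [h5, h6, Finset.sum_range_one, moebiusCoeff]
    field_simp
    ring
  rw [h7]
  exact hg

theorem norm_moebiusCoeff_succ {a w : ℂ} (n : ℕ) :
    ‖moebiusCoeff a w (n + 1)‖ = ‖w‖ * ‖1 - a * conj a‖ / ‖1 + w * a‖ ^ 2
      * ‖(w + conj a) / (1 + w * a)‖ ^ n := by
  rw [moebiusCoeff, norm_div, norm_mul, norm_mul, norm_pow, norm_pow, norm_div, div_pow, pow_add]
  ring

theorem norm_one_sub_mul_conj {a : ℂ} (ha : ‖a‖ < 1) : ‖1 - a * conj a‖ = 1 - ‖a‖ ^ 2 := by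
  rw [Complex.mul_conj', ← Complex.ofReal_pow, ← Complex.ofReal_one, ← Complex.ofReal_sub,
    Complex.norm_real, Real.norm_of_nonneg]
  nlinarith [norm_nonneg a]

theorem norm_moebiusCoeff_succ_le {a w : ℂ} (ha : ‖a‖ < 1) (hw : ‖w‖ < 1) (n : ℕ) :
    ‖moebiusCoeff a w (n + 1)‖ ≤ (1 - ‖a‖ ^ 2) / (1 - ‖w‖) ^ 2
      * ‖(w + conj a) / (1 + w * a)‖ ^ n := by
  rw [norm_moebiusCoeff_succ, norm_one_sub_mul_conj ha]
  have h1 := one_sub_norm_le_norm_one_add_mul (w := w) ha.le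
  have h2 : 0 ≤ 1 - ‖a‖ ^ 2 := by nlinarith [norm_nonneg a]
  have h3 : 0 < 1 - ‖w‖ := by linarith
  have : ‖w‖ * (1 - ‖a‖ ^ 2) ≤ 1 - ‖a‖ ^ 2 := mul_le_of_le_one_left h2 hw.le
  gcongr

/-- Uniformity in `a` is the point: along the segment `t a` the decay rate must not depend on `t`.
-/
theorem exists_norm_moebiusCoeff_le {A : ℝ} (hA : A < 1) {w : ℂ} (hw : ‖w‖ < 1) :
    ∃ C r : ℝ, 0 ≤ r ∧ r < 1 ∧ ∀ a : ℂ, ‖a‖ ≤ A → ∀ n, ‖moebiusCoeff a w n‖ ≤ C * r ^ n := by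
  by_cases hA0 : A < 0
  · exact ⟨0, 0, le_rfl, one_pos, fun a ha => absurd (norm_nonneg a) (by linarith)⟩
  push Not at hA0
  -- The `4` is the square of the bound `|1 + w a| ≤ 2`, so `1 - q` dominates the squared ratio for
  -- every `|a| ≤ A`.
  set q := (1 - ‖w‖ ^ 2) * (1 - A ^ 2) / 4 with hq
  have hw0 := norm_nonneg w
  have hw2 : 0 < 1 - ‖w‖ ^ 2 := by nlinarith
  have hA2 : 0 < 1 - A ^ 2 := by nlinarith
  have hq0 : 0 < q := by positivity
  have hq1 : q < 1 := by
    have : (1 - ‖w‖ ^ 2) * (1 - A ^ 2) ≤ 1 :=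
      mul_le_one₀ (by nlinarith) hA2.le (by nlinarith)
    linarith
  set r := Real.sqrt (1 - q) with hr
  have hr0 : 0 < r := Real.sqrt_pos.2 (by linarith)
  have hrsq : r ^ 2 = 1 - q := Real.sq_sqrt (by linarith)
  have hr1 : r < 1 := (sq_lt_one_iff₀ hr0.le).1 (by linarith)
  have h1w : 0 < 1 - ‖w‖ := by linarith
  refine ⟨((1 - ‖w‖) ^ 2)⁻¹ * r⁻¹ + (1 - ‖w‖)⁻¹, r, hr0.le, hr1, fun a ha n => ?_⟩
  have ha1 : ‖a‖ < 1 := ha.trans_lt hA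
  have hb := one_sub_norm_le_norm_one_add_mul (w := w) ha1.le
  cases n with
  | zero =>
    rw [moebiusCoeff, norm_inv, pow_zero, mul_one]
    have : ‖1 + w * a‖⁻¹ ≤ (1 - ‖w‖)⁻¹ := by gcongr
    have : 0 ≤ ((1 - ‖w‖) ^ 2)⁻¹ * r⁻¹ := by positivity
    linarith
  | succ n =>
    have hu : ‖(w + conj a) / (1 + w * a)‖ ≤ r := by
      refine (sq_le_sq₀ (norm_nonneg _) hr0.le).1 ?_
      rw [hrsq, norm_div_sq ha1 hw, hq]
      have h2 : ‖1 + w * a‖ ≤ 2 := by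
        refine (norm_add_le _ _).trans ?_
        rw [norm_one, norm_mul]
        nlinarith [norm_nonneg a]
      have h3 : 0 < ‖1 + w * a‖ := h1w.trans_le hb
      have h4 : ‖a‖ ^ 2 ≤ A ^ 2 := pow_le_pow_left₀ (norm_nonneg _) ha 2
      have h5 : ‖1 + w * a‖ ^ 2 ≤ 4 := by nlinarith
      have h6 : (1 - ‖w‖ ^ 2) * (1 - A ^ 2) / 4
          ≤ (1 - ‖w‖ ^ 2) * (1 - ‖a‖ ^ 2) / ‖1 + w * a‖ ^ 2 := by
        have : 0 ≤ 1 - ‖a‖ ^ 2 := by linarith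
        gcongr
      linarith
    calc ‖moebiusCoeff a w (n + 1)‖
        ≤ (1 - ‖a‖ ^ 2) / (1 - ‖w‖) ^ 2 * ‖(w + conj a) / (1 + w * a)‖ ^ n :=
          norm_moebiusCoeff_succ_le ha1 hw n
      _ ≤ 1 / (1 - ‖w‖) ^ 2 * r ^ n := by
          gcongr
          nlinarith [norm_nonneg a]
      _ = ((1 - ‖w‖) ^ 2)⁻¹ * r⁻¹ * r ^ (n + 1) := by
          rw [pow_succ]; field_simp; ring
      _ ≤ _ := by
          gcongr
          have : 0 ≤ (1 - ‖w‖)⁻¹ := by positivity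
          linarith

theorem hasDerivAt_moebiusCoeff_zero {a w : ℂ} (ha : ‖a‖ < 1) (hw : ‖w‖ < 1) {t : ℝ}
    (ht : t ∈ Set.Icc (0 : ℝ) 1) :
    HasDerivAt (fun t : ℝ => moebiusCoeff (t * a) w 0)
      (-a * moebiusCoeff (t * a) w 1 / (1 - (t : ℂ) ^ 2 * (a * conj a))) t := by
  have hta : ‖(t : ℂ) * a‖ < 1 := by
    rw [norm_mul, Complex.norm_real, Real.norm_of_nonneg ht.1]
    nlinarith [norm_nonneg a, ht.1, ht.2]
  have h1 := one_add_mul_ne_zero hta hw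
  have h2 : 1 - (t : ℂ) ^ 2 * (a * conj a) ≠ 0 := by
    have := one_sub_conj_mul_ne_zero hta hta.le
    rw [map_mul, Complex.conj_ofReal] at this
    convert this using 1
    ring
  have hd : HasDerivAt (fun t : ℝ => 1 + w * ((t : ℂ) * a)) (w * (1 * a)) t :=
    (((Complex.ofRealCLM.hasDerivAt (x := t)).mul_const a).const_mul w).const_add 1
  refine (hd.inv h1).congr_deriv ?_
  simp only [moebiusCoeff, map_mul, Complex.conj_ofReal]
  rw [show 1 - (t : ℂ) * a * (t * conj a) = 1 - (t : ℂ) ^ 2 * (a * conj a) by ring]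
  generalize 1 - (t : ℂ) ^ 2 * (a * conj a) = s at h2 ⊢
  generalize 1 + w * ((t : ℂ) * a) = D at h1 ⊢
  field_simp

theorem hasDerivAt_moebiusCoeff_succ {a w : ℂ} (ha : ‖a‖ < 1) (hw : ‖w‖ < 1) {t : ℝ}
    (ht : t ∈ Set.Icc (0 : ℝ) 1) (n : ℕ) :
    HasDerivAt (fun t : ℝ => moebiusCoeff (t * a) w (n + 1))
      ((conj a * n * moebiusCoeff (t * a) w n - a * (n + 2) * moebiusCoeff (t * a) w (n + 2))
        / (1 - (t : ℂ) ^ 2 * (a * conj a))) t := by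
  have hta : ‖(t : ℂ) * a‖ < 1 := by
    rw [norm_mul, Complex.norm_real, Real.norm_of_nonneg ht.1]
    nlinarith [norm_nonneg a, ht.1, ht.2]
  have h1 := one_add_mul_ne_zero hta hw
  have h2 : 1 - (t : ℂ) ^ 2 * (a * conj a) ≠ 0 := by
    have := one_sub_conj_mul_ne_zero hta hta.le
    rw [map_mul, Complex.conj_ofReal] at this
    convert this using 1
    ring
  have ht1 : HasDerivAt (fun t : ℝ => (t : ℂ)) 1 t := Complex.ofRealCLM.hasDerivAt (x := t)
  have hd : HasDerivAt (fun t : ℝ => 1 + w * ((t : ℂ) * a)) (w * (1 * a)) t :=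
    ((ht1.mul_const a).const_mul w).const_add 1
  have hn : HasDerivAt (fun t : ℝ => w + (t : ℂ) * conj a) (1 * conj a) t :=
    (ht1.mul_const (conj a)).const_add w
  have hs : HasDerivAt (fun t : ℝ => w * (1 - (t : ℂ) ^ 2 * (a * conj a)))
      (w * -((2 : ℕ) * (t : ℂ) ^ (2 - 1) * 1 * (a * conj a))) t :=
    (((ht1.pow 2).mul_const (a * conj a)).const_sub 1).const_mul w
  have key := ((hs.mul (hn.pow n)).div (hd.pow (n + 2)) (pow_ne_zero _ h1))
  have e : (fun t : ℝ => moebiusCoeff (t * a) w (n + 1))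
      = fun t : ℝ => w * (1 - (t : ℂ) ^ 2 * (a * conj a)) * (w + (t : ℂ) * conj a) ^ n
        / (1 + w * ((t : ℂ) * a)) ^ (n + 2) := by
    funext t
    simp only [moebiusCoeff, map_mul, Complex.conj_ofReal]
    ring
  rw [e]
  refine key.congr_deriv ?_
  -- With `s = 1 - t² |a|²`, `D = 1 + w t a` and `N = w + t ā`, the relations `s = D - t a N` and `w
  -- s = N - t ā D` are all that the derivative formula needs once `s`, `D`, `N` are made
  -- independent variables. The case `n = 0` is separate because the coefficient of index `0` has
  -- another form; there its factor `n` vanishes.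
  have hsD : 1 - (t : ℂ) ^ 2 * (a * conj a)
      = (1 + w * ((t : ℂ) * a)) - t * a * (w + (t : ℂ) * conj a) := by ring
  have hsN : w * (1 - (t : ℂ) ^ 2 * (a * conj a))
      = (w + (t : ℂ) * conj a) - t * conj a * (1 + w * ((t : ℂ) * a)) := by ring
  have hss : 1 - (t : ℂ) * a * (t * conj a) = 1 - (t : ℂ) ^ 2 * (a * conj a) := by ring
  cases n with
  | zero =>
    simp only [moebiusCoeff, map_mul, Complex.conj_ofReal, Pi.pow_apply, Pi.mul_apply, hss]
    generalize 1 - (t : ℂ) ^ 2 * (a * conj a) = s at *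
    generalize 1 + w * ((t : ℂ) * a) = D at *
    generalize w + (t : ℂ) * conj a = N at *
    generalize conj a = b at *
    field_simp
    push_cast
    linear_combination (-2 * a * w * s * D ^ 5) * hsN
  | succ n =>
    simp only [moebiusCoeff, map_mul, Complex.conj_ofReal, Pi.pow_apply, Pi.mul_apply, hss,
      Nat.add_sub_cancel]
    generalize 1 - (t : ℂ) ^ 2 * (a * conj a) = s at *
    generalize 1 + w * ((t : ℂ) * a) = D at *
    generalize w + (t : ℂ) * conj a = N at *
    generalize conj a = b at *
    field_simp
    push_cast
    linear_combination
      (w * D ^ (8 + 3 * n) * N ^ n) * ((n + 1) * b * D * hsD - (n + 3) * a * N * hsN)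

/-! ### Boundedness of the composition operators -/

/-- By convexity the power lies below its chord on `[0, 1]`. -/
theorem one_add_pow_le_one_add_two_pow_mul (k : ℕ) {x : ℝ} (h0 : 0 ≤ x) (h1 : x ≤ 1) :
    (1 + x) ^ k ≤ 1 + (2 ^ k - 1) * x := by
  induction k with
  | zero => simp
  | succ k ih =>
    have h2 : (1 : ℝ) ≤ 2 ^ k := one_le_pow₀ (by norm_num)
    calc (1 + x) ^ (k + 1) = (1 + x) ^ k * (1 + x) := pow_succ _ _
      _ ≤ (1 + (2 ^ k - 1) * x) * (1 + x) := by gcongr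
      _ ≤ 1 + (2 ^ (k + 1) - 1) * x := by
        rw [pow_succ]
        nlinarith [mul_nonneg (mul_nonneg (sub_nonneg.2 h2) h0) (sub_nonneg.2 h1)]

theorem abs_one_add_rpow_sub_one_le (β : ℝ) {x : ℝ} (h0 : 0 ≤ x) (h1 : x ≤ 1) :
    |(1 + x) ^ β - 1| ≤ 2 ^ ⌈|β|⌉₊ * x := by
  have hbase : (1 : ℝ) ≤ 1 + x := by linarith
  have hup : (1 + x) ^ |β| ≤ 1 + 2 ^ ⌈|β|⌉₊ * x := by
    calc (1 + x) ^ |β| ≤ (1 + x) ^ (⌈|β|⌉₊ : ℝ) :=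
          Real.rpow_le_rpow_of_exponent_le hbase (Nat.le_ceil _)
      _ = (1 + x) ^ ⌈|β|⌉₊ := Real.rpow_natCast _ _
      _ ≤ 1 + (2 ^ ⌈|β|⌉₊ - 1) * x := one_add_pow_le_one_add_two_pow_mul _ h0 h1
      _ ≤ _ := by nlinarith
  have hone : 1 ≤ (1 + x) ^ |β| := Real.one_le_rpow hbase (abs_nonneg _)
  rcases le_total 0 β with hβ | hβ
  · rw [abs_of_nonneg hβ] at *
    rw [abs_of_nonneg (by linarith)]
    linarith
  · rw [abs_of_nonpos hβ, Real.rpow_neg (by linarith)] at hone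
    rw [abs_of_nonpos hβ, Real.rpow_neg (by linarith)] at hup
    have hp : 0 < (1 + x) ^ β := Real.rpow_pos_of_pos (by linarith) _
    have hle : (1 + x) ^ β ≤ 1 := by
      have := mul_le_mul_of_nonneg_right hone hp.le
      rwa [inv_mul_cancel₀ hp.ne', one_mul] at this
    rw [abs_of_nonpos hβ, abs_of_nonpos (by linarith)]
    have : 1 - (1 + x) ^ β ≤ ((1 + x) ^ β)⁻¹ - 1 := by
      have h3 : (1 + x) ^ β * ((1 + x) ^ β)⁻¹ = 1 := mul_inv_cancel₀ hp.ne'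
      nlinarith
    linarith

theorem sqWeight_succ (ν : ℝ) (n : ℕ) :
    sqWeight ν (n + 1) = sqWeight ν n * (1 + ((n : ℝ) + 1)⁻¹) ^ (2 * ν) := by
  rw [sqWeight_eq, sqWeight_eq, ← Real.mul_rpow (by positivity) (by positivity)]
  congr 1
  push_cast
  field_simp

/-- Since `β_{n+1}² / β_n² = 1 + O(1/n)`, the terms of order `n β_n²` cancel. Bounds by both
neighbouring weights are needed to split `|c_n| |c_{n+1}|`. -/
theorem exists_abs_sqWeight_increment_le (ν : ℝ) :
    ∃ K : ℝ, 0 ≤ K ∧ ∀ n : ℕ,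
      |n * sqWeight ν (n + 1) - (n + 1) * sqWeight ν n| ≤ K * sqWeight ν n ∧
      |n * sqWeight ν (n + 1) - (n + 1) * sqWeight ν n| ≤ K * sqWeight ν (n + 1) := by
  set B : ℝ := 2 ^ ⌈|2 * ν|⌉₊ with hB
  have hB0 : 0 ≤ B := by positivity
  -- One factor `B + 1` bounds the increment relative to `β_n²`, the other bounds `β_n² / β_{n+1}²`.
  refine ⟨(B + 1) * (B + 1), by positivity, fun n => ?_⟩
  set x : ℝ := ((n : ℝ) + 1)⁻¹ with hx
  have hx0 : 0 ≤ x := by positivity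
  have hx1 : x ≤ 1 := inv_le_one_of_one_le₀ (by linarith [(Nat.cast_nonneg n : (0 : ℝ) ≤ n)])
  have hnx : n * x ≤ 1 := by
    rw [hx, ← div_eq_mul_inv, div_le_one (by positivity)]
    linarith
  have hw := sqWeight_pos ν n
  have h1 := abs_one_add_rpow_sub_one_le (2 * ν) hx0 hx1
  have h2 := abs_one_add_rpow_sub_one_le (-(2 * ν)) hx0 hx1
  rw [abs_neg, ← hB] at h2
  rw [← hB] at h1
  set ρ := (1 + x) ^ (2 * ν) with hρ
  have hρ0 : 0 < ρ := Real.rpow_pos_of_pos (by linarith) _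
  rw [Real.rpow_neg (by linarith), ← hρ] at h2
  have hsucc : sqWeight ν (n + 1) = sqWeight ν n * ρ := sqWeight_succ ν n
  have hinv : ρ⁻¹ ≤ B + 1 := by
    have := (le_abs_self _).trans h2
    nlinarith
  have hmain : |n * sqWeight ν (n + 1) - (n + 1) * sqWeight ν n| ≤ (B + 1) * sqWeight ν n := by
    rw [hsucc, show n * (sqWeight ν n * ρ) - (n + 1) * sqWeight ν n
      = (n * (ρ - 1) - 1) * sqWeight ν n by ring, abs_mul, abs_of_pos hw]
    refine mul_le_mul_of_nonneg_right ?_ hw.le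
    calc |n * (ρ - 1) - 1| ≤ |n * (ρ - 1)| + |(1 : ℝ)| := abs_sub _ _
      _ = n * |ρ - 1| + 1 := by rw [abs_mul, Nat.abs_cast, abs_one]
      _ ≤ n * (B * x) + 1 := by gcongr
      _ = B * (n * x) + 1 := by ring
      _ ≤ B + 1 := by nlinarith
  refine ⟨hmain.trans ?_, hmain.trans ?_⟩
  · have : (B + 1) * 1 ≤ (B + 1) * (B + 1) := by nlinarith
    nlinarith
  · have h3 : sqWeight ν n = sqWeight ν n * ρ * ρ⁻¹ := by field_simp
    have h4 : sqWeight ν n ≤ sqWeight ν (n + 1) * (B + 1) := by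
      rw [hsucc]
      calc sqWeight ν n = sqWeight ν n * ρ * ρ⁻¹ := h3
        _ ≤ _ := by gcongr
    calc (B + 1) * sqWeight ν n ≤ (B + 1) * (sqWeight ν (n + 1) * (B + 1)) := by gcongr
      _ = _ := by ring

/-- A curve `t ↦ c t` of coefficient sequences that is the flow, for `0 ≤ t ≤ 1`, of the vector
field `(ā z² - a) (1 - t² |a|²)⁻¹ ∂_z`, with uniformly geometric decay. -/
structure IsMoebiusFlow (a : ℂ) (c : ℝ → ℕ → ℂ) : Prop where
  hasDerivAt_zero : ∀ t ∈ Set.Icc (0 : ℝ) 1, HasDerivAt (fun t => c t 0)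
    (-a * c t 1 / (1 - (t : ℂ) ^ 2 * (a * conj a))) t
  hasDerivAt_succ : ∀ t ∈ Set.Icc (0 : ℝ) 1, ∀ n : ℕ, HasDerivAt (fun t => c t (n + 1))
    ((conj a * n * c t n - a * (n + 2) * c t (n + 2)) / (1 - (t : ℂ) ^ 2 * (a * conj a))) t
  decay : ∃ C r : ℝ, 0 ≤ r ∧ r < 1 ∧ ∀ t ∈ Set.Icc (0 : ℝ) 1, ∀ n, ‖c t n‖ ≤ C * r ^ n

theorem IsMoebiusFlow.add {a : ℂ} {c d : ℝ → ℕ → ℂ} (hc : IsMoebiusFlow a c)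
    (hd : IsMoebiusFlow a d) : IsMoebiusFlow a (c + d) where
  hasDerivAt_zero t ht := by
    refine ((hc.hasDerivAt_zero t ht).add (hd.hasDerivAt_zero t ht)).congr_deriv ?_
    simp only [Pi.add_apply]; ring
  hasDerivAt_succ t ht n := by
    refine ((hc.hasDerivAt_succ t ht n).add (hd.hasDerivAt_succ t ht n)).congr_deriv ?_
    simp only [Pi.add_apply]; ring
  decay := by
    obtain ⟨C, r, hr0, hr1, h⟩ := hc.decay
    obtain ⟨D, s, hs0, hs1, h'⟩ := hd.decay
    have hC : 0 ≤ C := by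
      simpa using (norm_nonneg _).trans (h 0 ⟨le_rfl, zero_le_one⟩ 0)
    have hD : 0 ≤ D := by
      simpa using (norm_nonneg _).trans (h' 0 ⟨le_rfl, zero_le_one⟩ 0)
    refine ⟨C + D, max r s, le_max_of_le_left hr0, max_lt hr1 hs1, fun t ht n => ?_⟩
    have h1 : r ^ n ≤ max r s ^ n := pow_le_pow_left₀ hr0 (le_max_left _ _) n
    have h2 : s ^ n ≤ max r s ^ n := pow_le_pow_left₀ hs0 (le_max_right _ _) n
    calc ‖c t n + d t n‖ ≤ ‖c t n‖ + ‖d t n‖ := norm_add_le _ _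
      _ ≤ C * r ^ n + D * s ^ n := add_le_add (h t ht n) (h' t ht n)
      _ ≤ C * max r s ^ n + D * max r s ^ n := by gcongr
      _ = _ := by ring

theorem IsMoebiusFlow.const_smul {a : ℂ} {c : ℝ → ℕ → ℂ} (hc : IsMoebiusFlow a c) (k : ℂ) :
    IsMoebiusFlow a (fun t n => k * c t n) where
  hasDerivAt_zero t ht := by
    refine ((hc.hasDerivAt_zero t ht).const_mul k).congr_deriv ?_
    ring
  hasDerivAt_succ t ht n := by
    refine ((hc.hasDerivAt_succ t ht n).const_mul k).congr_deriv ?_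
    ring
  decay := by
    obtain ⟨C, r, hr0, hr1, h⟩ := hc.decay
    refine ⟨‖k‖ * C, r, hr0, hr1, fun t ht n => ?_⟩
    rw [norm_mul, mul_assoc]
    exact mul_le_mul_of_nonneg_left (h t ht n) (norm_nonneg _)

theorem norm_ofReal_mul_le {a : ℂ} {t : ℝ} (ht : t ∈ Set.Icc (0 : ℝ) 1) : ‖(t : ℂ) * a‖ ≤ ‖a‖ := by
  rw [norm_mul, Complex.norm_real, Real.norm_of_nonneg ht.1]
  exact mul_le_of_le_one_left (norm_nonneg _) ht.2

theorem isMoebiusFlow_moebiusCoeff {a w : ℂ} (ha : ‖a‖ < 1) (hw : ‖w‖ < 1) :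
    IsMoebiusFlow a (fun t => moebiusCoeff (t * a) w) where
  hasDerivAt_zero t ht := hasDerivAt_moebiusCoeff_zero ha hw ht
  hasDerivAt_succ t ht n := hasDerivAt_moebiusCoeff_succ ha hw ht n
  decay := by
    obtain ⟨C, r, hr0, hr1, h⟩ := exists_norm_moebiusCoeff_le ha hw
    exact ⟨C, r, hr0, hr1, fun t ht n => h _ (norm_ofReal_mul_le ht) n⟩

/-- Summation by parts for the derivative of the truncated energy along the flow. -/
theorem sum_energy_derivative (w : ℕ → ℝ) (a : ℂ) (c : ℕ → ℂ) (s : ℝ) (M : ℕ) :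
    w 0 * (2 * (conj (c 0) * (-a * c 1 / s)).re)
      + ∑ n ∈ Finset.range M, w (n + 1) *
        (2 * (conj (c (n + 1)) * ((conj a * n * c n - a * (n + 2) * c (n + 2)) / s)).re)
      = 2 / s * (∑ n ∈ Finset.range M, (n * w (n + 1) - (n + 1) * w n)
          * (a * conj (c n) * c (n + 1)).re
        - (M + 1) * w M * (a * conj (c M) * c (M + 1)).re) := by
  induction M with
  | zero =>
    rw [show conj (c 0) * (-a * c 1 / s) = ((s⁻¹ : ℝ) : ℂ) * -(a * conj (c 0) * c 1) by
      push_cast; ring, Complex.re_ofReal_mul]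
    simp
    ring
  | succ M ih =>
    rw [Finset.sum_range_succ, ← add_assoc, ih, Finset.sum_range_succ]
    -- The new incoming term and the old boundary term are complex conjugates, so their real parts
    -- combine into a single weight increment.
    have h1 : (conj a * conj (c (M + 1)) * c M).re = (a * conj (c M) * c (M + 1)).re := by
      rw [← Complex.conj_re]
      simp only [map_mul, Complex.conj_conj]
      congr 1
      ring
    rw [show conj (c (M + 1)) * ((conj a * M * c M - a * (M + 2) * c (M + 2)) / s)
      = ((s⁻¹ : ℝ) : ℂ) * (((M : ℝ) : ℂ) * (conj a * conj (c (M + 1)) * c M)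
        - ((M + 2 : ℝ) : ℂ) * (a * conj (c (M + 1)) * c (M + 2))) by push_cast; ring,
      Complex.re_ofReal_mul, Complex.sub_re, Complex.re_ofReal_mul, Complex.re_ofReal_mul, h1]
    push_cast
    ring

/-- The truncated energy of a curve of coefficient sequences. -/
def energy (ν : ℝ) (M : ℕ) (c : ℕ → ℂ) : ℝ := ∑ n ∈ Finset.range M, ‖c n‖ ^ 2 * sqWeight ν n

/-- Split `|c_n| |c_{n+1}|` as half the sum of squares and compare each square with its own weight;
every energy term is then counted at most twice. -/
theorem energy_deriv_bound {ν K : ℝ} (hK0 : 0 ≤ K) (hK : ∀ n : ℕ,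
      |n * sqWeight ν (n + 1) - (n + 1) * sqWeight ν n| ≤ K * sqWeight ν n ∧
      |n * sqWeight ν (n + 1) - (n + 1) * sqWeight ν n| ≤ K * sqWeight ν (n + 1))
    {a : ℂ} (ha : ‖a‖ < 1) (c : ℕ → ℂ) (M : ℕ) :
    |∑ n ∈ Finset.range M, (n * sqWeight ν (n + 1) - (n + 1) * sqWeight ν n)
          * (a * conj (c n) * c (n + 1)).re| ≤ K * energy ν (M + 1) c := by
  have hre : ∀ n, |(a * conj (c n) * c (n + 1)).re| ≤ ‖c n‖ * ‖c (n + 1)‖ := fun n => by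
    refine (Complex.abs_re_le_norm _).trans ?_
    rw [norm_mul, norm_mul, RCLike.norm_conj, mul_assoc]
    exact mul_le_of_le_one_left (by positivity) ha.le
  have hterm : ∀ n : ℕ, |(n * sqWeight ν (n + 1) - (n + 1) * sqWeight ν n)
      * (a * conj (c n) * c (n + 1)).re|
      ≤ K / 2 * (‖c n‖ ^ 2 * sqWeight ν n + ‖c (n + 1)‖ ^ 2 * sqWeight ν (n + 1)) := fun n => by
    rw [abs_mul]
    obtain ⟨h1, h2⟩ := hK n
    set E := |n * sqWeight ν (n + 1) - (n + 1) * sqWeight ν n|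
    have hE : 0 ≤ E := abs_nonneg _
    calc E * |(a * conj (c n) * c (n + 1)).re| ≤ E * (‖c n‖ * ‖c (n + 1)‖) := by gcongr; exact hre n
      _ ≤ E * ((‖c n‖ ^ 2 + ‖c (n + 1)‖ ^ 2) / 2) := by
          gcongr; nlinarith [sq_nonneg (‖c n‖ - ‖c (n + 1)‖)]
      _ = (‖c n‖ ^ 2 * E + ‖c (n + 1)‖ ^ 2 * E) / 2 := by ring
      _ ≤ (‖c n‖ ^ 2 * (K * sqWeight ν n) + ‖c (n + 1)‖ ^ 2 * (K * sqWeight ν (n + 1))) / 2 := by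
          gcongr
      _ = _ := by ring
  have hpos : ∀ n, 0 ≤ ‖c n‖ ^ 2 * sqWeight ν n := fun n =>
    mul_nonneg (sq_nonneg _) (sqWeight_pos ν n).le
  have h1 : ∑ n ∈ Finset.range M, ‖c n‖ ^ 2 * sqWeight ν n ≤ energy ν (M + 1) c := by
    rw [energy, Finset.sum_range_succ]; linarith [hpos M]
  have h2 : ∑ n ∈ Finset.range M, ‖c (n + 1)‖ ^ 2 * sqWeight ν (n + 1) ≤ energy ν (M + 1) c := by
    rw [energy, Finset.sum_range_succ']; linarith [hpos 0]
  calc _ ≤ ∑ n ∈ Finset.range M, |(n * sqWeight ν (n + 1) - (n + 1) * sqWeight ν n)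
          * (a * conj (c n) * c (n + 1)).re| := Finset.abs_sum_le_sum_abs _ _
    _ ≤ ∑ n ∈ Finset.range M,
        K / 2 * (‖c n‖ ^ 2 * sqWeight ν n + ‖c (n + 1)‖ ^ 2 * sqWeight ν (n + 1)) :=
      Finset.sum_le_sum fun n _ => hterm n
    _ = K / 2 * (∑ n ∈ Finset.range M, ‖c n‖ ^ 2 * sqWeight ν n
        + ∑ n ∈ Finset.range M, ‖c (n + 1)‖ ^ 2 * sqWeight ν (n + 1)) := by
      rw [← Finset.mul_sum, Finset.sum_add_distrib]
    _ ≤ K / 2 * (energy ν (M + 1) c + energy ν (M + 1) c) := by gcongr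
    _ = _ := by ring

/-- A Grönwall inequality on the unit interval. -/
theorem le_exp_mul_of_hasDerivAt_le {Q Q' : ℝ → ℝ} {L η : ℝ} (hL : 0 ≤ L) (hη : 0 ≤ η)
    (hd : ∀ t ∈ Set.Icc (0 : ℝ) 1, HasDerivAt Q (Q' t) t)
    (hb : ∀ t ∈ Set.Icc (0 : ℝ) 1, Q' t ≤ L * Q t + η) :
    Q 1 ≤ Real.exp L * (Q 0 + η) := by
  have hg : ∀ t ∈ Set.Icc (0 : ℝ) 1, HasDerivAt (fun t => Real.exp (-L * t) * Q t - η * t)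
      (Real.exp (-L * t) * (-L * 1) * Q t + Real.exp (-L * t) * Q' t - η * 1) t := fun t ht =>
    ((((hasDerivAt_id t).const_mul (-L)).exp).mul (hd t ht)).sub ((hasDerivAt_id t).const_mul η)
  -- The derivative is at most `(exp (-L t) - 1) η ≤ 0`.
  have hanti : AntitoneOn (fun t => Real.exp (-L * t) * Q t - η * t) (Set.Icc 0 1) := by
    refine antitoneOn_of_deriv_nonpos (convex_Icc 0 1)
      (fun t ht => (hg t ht).continuousAt.continuousWithinAt)
      (fun t ht => (hg t (interior_subset ht)).differentiableAt.differentiableWithinAt)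
      fun t ht => ?_
    have ht' := interior_subset ht
    rw [(hg t ht').deriv]
    have he : Real.exp (-L * t) ≤ 1 := Real.exp_le_one_iff.2 (by nlinarith [ht'.1])
    have he0 := Real.exp_pos (-L * t)
    have := mul_le_mul_of_nonneg_left (hb t ht') he0.le
    nlinarith
  have h := hanti (Set.left_mem_Icc.2 zero_le_one) (Set.right_mem_Icc.2 zero_le_one) zero_le_one
  simp only [mul_one, mul_zero, Real.exp_zero, one_mul, sub_zero] at h
  have h1 : Real.exp L * Real.exp (-L) = 1 := by rw [← Real.exp_add]; simp
  have := mul_le_mul_of_nonneg_left (sub_le_iff_le_add.1 h) (Real.exp_pos L).le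
  rwa [← mul_assoc, h1, one_mul] at this

theorem IsMoebiusFlow.hasDerivAt_energy {a : ℂ} {c : ℝ → ℕ → ℂ} (hc : IsMoebiusFlow a c)
    (ν : ℝ) (M : ℕ) {t : ℝ} (ht : t ∈ Set.Icc (0 : ℝ) 1) :
    HasDerivAt (fun t => energy ν (M + 1) (c t))
      (2 / (1 - t ^ 2 * ‖a‖ ^ 2) * (∑ n ∈ Finset.range M,
          (n * sqWeight ν (n + 1) - (n + 1) * sqWeight ν n)
          * (a * conj (c t n) * c t (n + 1)).re
        - (M + 1) * sqWeight ν M * (a * conj (c t M) * c t (M + 1)).re)) t := by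
  have hs : 1 - (t : ℂ) ^ 2 * (a * conj a) = ((1 - t ^ 2 * ‖a‖ ^ 2 : ℝ) : ℂ) := by
    rw [Complex.mul_conj']; push_cast; rfl
  have h0 := (hc.hasDerivAt_zero t ht).norm_sq.mul_const (sqWeight ν 0)
  have hn := fun n => (hc.hasDerivAt_succ t ht n).norm_sq.mul_const (sqWeight ν (n + 1))
  have hsum := (HasDerivAt.fun_sum (u := Finset.range M) fun n _ => hn n).add h0
  have e : (fun t => energy ν (M + 1) (c t)) = fun t => ∑ n ∈ Finset.range M,
      ‖c t (n + 1)‖ ^ 2 * sqWeight ν (n + 1) + ‖c t 0‖ ^ 2 * sqWeight ν 0 := by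
    funext t
    rw [energy, Finset.sum_range_succ']
  rw [e]
  refine hsum.congr_deriv ?_
  rw [← sum_energy_derivative, hs, add_comm]
  congr 1
  · rw [Complex.inner, mul_comm _ (conj (c t 0)), mul_comm]
  · refine Finset.sum_congr rfl fun n _ => ?_
    rw [Complex.inner, mul_comm _ (conj (c t (n + 1))), mul_comm]

/-- Truncation at `M` leaves a boundary term in the energy derivative; uniform geometric decay makes
it a uniformly small error `η M`, so that Grönwall applies to each truncation and the limit is
clean. -/
theorem IsMoebiusFlow.energy_le {ν K : ℝ} (hK0 : 0 ≤ K) (hK : ∀ n : ℕ,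
      |n * sqWeight ν (n + 1) - (n + 1) * sqWeight ν n| ≤ K * sqWeight ν n ∧
      |n * sqWeight ν (n + 1) - (n + 1) * sqWeight ν n| ≤ K * sqWeight ν (n + 1))
    {a : ℂ} (ha : ‖a‖ < 1) {c : ℝ → ℕ → ℂ} (hc : IsMoebiusFlow a c) :
    ∃ η : ℕ → ℝ, Tendsto η atTop (𝓝 0) ∧ ∀ M, energy ν (M + 1) (c 1)
      ≤ Real.exp (2 / (1 - ‖a‖ ^ 2) * K) * (energy ν (M + 1) (c 0) + η M) := by
  obtain ⟨C, r, hr0, hr1, hCr⟩ := hc.decay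
  have hC : 0 ≤ C := by
    simpa using (norm_nonneg _).trans (hCr 0 ⟨le_rfl, zero_le_one⟩ 0)
  set B := 2 / (1 - ‖a‖ ^ 2) with hB
  have ha2 : 0 < 1 - ‖a‖ ^ 2 := by nlinarith [norm_nonneg a]
  have hB0 : 0 ≤ B := by positivity
  -- Raising the exponent by `1/2` multiplies the squared weight by `M + 1`, the factor in the
  -- boundary term.
  have hη := ((summable_geometric_mul_sqWeight (ν + 1 / 2) (sq_nonneg r)
    (by nlinarith)).tendsto_atTop_zero.const_mul (B * C ^ 2))
  rw [mul_zero] at hη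
  refine ⟨_, hη, fun M => ?_⟩
  have hwM : sqWeight (ν + 1 / 2) M = (M + 1) * sqWeight ν M := by
    rw [sqWeight_eq, sqWeight_eq, mul_add, Real.rpow_add (by positivity)]
    norm_num [mul_comm]
  have hw0 := sqWeight_pos ν M
  refine le_exp_mul_of_hasDerivAt_le (Q := fun t => energy ν (M + 1) (c t)) (by positivity) ?_
    (fun t ht => hc.hasDerivAt_energy ν M ht) fun t ht => ?_
  · have := sqWeight_pos (ν + 1 / 2) M
    positivity
  set X := ∑ n ∈ Finset.range M, (n * sqWeight ν (n + 1) - (n + 1) * sqWeight ν n)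
          * (a * conj (c t n) * c t (n + 1)).re
  set Y := (M + 1) * sqWeight ν M * (a * conj (c t M) * c t (M + 1)).re with hY
  have hX : |X| ≤ K * energy ν (M + 1) (c t) := energy_deriv_bound hK0 hK ha (c t) M
  have hYb : |Y| ≤ C ^ 2 * ((r ^ 2) ^ M * sqWeight (ν + 1 / 2) M) := by
    rw [hY, abs_mul, abs_of_pos (by positivity : 0 < ((M : ℝ) + 1) * sqWeight ν M), hwM]
    have h1 : |(a * conj (c t M) * c t (M + 1)).re| ≤ (C * r ^ M) * (C * r ^ M) := by
      refine (Complex.abs_re_le_norm _).trans ?_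
      rw [norm_mul, norm_mul, RCLike.norm_conj, mul_assoc]
      refine (mul_le_of_le_one_left (by positivity) ha.le).trans ?_
      have h2 := (hCr t ht (M + 1)).trans (mul_le_mul_of_nonneg_left
        (pow_le_pow_of_le_one hr0 hr1.le (Nat.le_succ M)) hC)
      exact mul_le_mul (hCr t ht M) h2 (norm_nonneg _) (by positivity)
    calc _ ≤ (M + 1) * sqWeight ν M * ((C * r ^ M) * (C * r ^ M)) := by gcongr
      _ = _ := by ring
  have hst : 2 / (1 - t ^ 2 * ‖a‖ ^ 2) ≤ B := by
    rw [hB]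
    have : t ^ 2 ≤ 1 := by nlinarith [ht.1, ht.2]
    have : t ^ 2 * ‖a‖ ^ 2 ≤ ‖a‖ ^ 2 := mul_le_of_le_one_left (sq_nonneg _) this
    gcongr
  have hst0 : 0 ≤ 2 / (1 - t ^ 2 * ‖a‖ ^ 2) := by
    have : t ^ 2 ≤ 1 := by nlinarith [ht.1, ht.2]
    have : t ^ 2 * ‖a‖ ^ 2 ≤ ‖a‖ ^ 2 := mul_le_of_le_one_left (sq_nonneg _) this
    exact div_nonneg zero_le_two (by linarith)
  calc 2 / (1 - t ^ 2 * ‖a‖ ^ 2) * (X - Y) ≤ 2 / (1 - t ^ 2 * ‖a‖ ^ 2) * (|X| + |Y|) := by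
        gcongr
        linarith [le_abs_self X, neg_abs_le Y]
    _ ≤ B * (|X| + |Y|) := by gcongr
    _ ≤ B * (K * energy ν (M + 1) (c t) + C ^ 2 * ((r ^ 2) ^ M * sqWeight (ν + 1 / 2) M)) := by
        gcongr
    _ = _ := by ring

/-- `φ` is the disc automorphism `z ↦ l (z - a) / (1 - ā z)`, where `|l| = 1` and `|a| < 1`. -/
structure IsMoebius (l a : ℂ) (φ : 𝔻 → 𝔻) : Prop where
  norm_left : ‖l‖ = 1
  norm_right : ‖a‖ < 1
  apply_eq : ∀ z : 𝔻, (φ z : ℂ) = l * (((z : ℂ) - a) / (1 - conj a * z))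

theorem moebiusCoeff_zero_left (w : ℂ) (n : ℕ) : moebiusCoeff 0 w n = w ^ n := by
  cases n with
  | zero => simp [moebiusCoeff]
  | succ n => simp [moebiusCoeff, pow_succ, mul_comm]

/-! ### The composition operator, from the span of kernels to the whole space. -/

namespace IsMoebius

variable {l a : ℂ} {φ : 𝔻 → 𝔻} {ν : ℝ}

theorem norm_mul_lt_one (h : IsMoebius l a φ) (w : 𝔻) : ‖l * w‖ < 1 := by
  rw [norm_mul, h.norm_left, one_mul]; exact w.norm_lt_one

theorem isTaylor_kernel_comp (h : IsMoebius l a φ) (w : 𝔻) :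
    IsTaylor (moebiusCoeff a (l * w)) fun z => S.kernel ν w (φ z) := by
  intro z
  beta_reduce
  rw [S.kernel_apply, h.apply_eq, ← mul_assoc, mul_comm (w : ℂ) l]
  exact hasSum_moebiusCoeff h.norm_right (h.norm_mul_lt_one w) z.norm_lt_one

/-- The flow equations are linear, so the explicit flows of kernels add up. At `t = 0` the curve is
the rotated function `f(l z)`, of the same norm as `f`; at `t = 1` it is `f ∘ φ`. -/
theorem exists_flow (h : IsMoebius l a φ) {f : S ν}
    (hf : f ∈ Submodule.span ℂ (Set.range (S.kernel ν))) :
    ∃ c : ℝ → ℕ → ℂ, IsMoebiusFlow a c ∧ (∀ n, c 0 n = l ^ n * f.coeff n) ∧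
      IsTaylor (c 1) fun z => f (φ z) := by
  induction hf using Submodule.span_induction with
  | mem f hf =>
    obtain ⟨w, rfl⟩ := hf
    refine ⟨_, isMoebiusFlow_moebiusCoeff h.norm_right (h.norm_mul_lt_one w), fun n => ?_, ?_⟩
    · rw [Complex.ofReal_zero, zero_mul, moebiusCoeff_zero_left, S.coeff_kernel, mul_pow]
    · simpa using h.isTaylor_kernel_comp w
  | zero =>
    refine ⟨fun _ _ => 0, ⟨fun t _ => ?_, fun t _ n => ?_, 0, 0, le_rfl, one_pos, by simp⟩,
      fun n => by simp [S.coeff_zero], fun z => ?_⟩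
    · simpa using hasDerivAt_const t (0 : ℂ)
    · simpa using hasDerivAt_const t (0 : ℂ)
    · simp only [zero_mul]
      exact hasSum_zero
  | add f g _ _ ihf ihg =>
    obtain ⟨c, hc, hc0, hc1⟩ := ihf
    obtain ⟨d, hd, hd0, hd1⟩ := ihg
    refine ⟨c + d, hc.add hd, fun n => ?_, fun z => ?_⟩
    · simp only [Pi.add_apply, hc0, hd0, S.coeff_add]; ring
    · simpa [add_mul, S.coe_add] using (hc1 z).add (hd1 z)
  | smul k f _ ihf =>
    obtain ⟨c, hc, hc0, hc1⟩ := ihf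
    refine ⟨_, hc.const_smul k, fun n => ?_, fun z => ?_⟩
    · simp only [hc0, S.coeff_smul]; ring
    · simpa [mul_assoc, S.coe_smul] using (hc1 z).mul_left k

theorem exists_bound (h : IsMoebius l a φ) (ν : ℝ) :
    ∃ B : ℝ, ∀ f ∈ Submodule.span ℂ (Set.range (S.kernel ν)),
      ∃ g : S ν, (∀ z, g z = f (φ z)) ∧ ‖g‖ ≤ B * ‖f‖ := by
  obtain ⟨K, hK0, hK⟩ := exists_abs_sqWeight_increment_le ν
  set E := Real.exp (2 / (1 - ‖a‖ ^ 2) * K)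
  have hE : 0 ≤ E := (Real.exp_pos _).le
  refine ⟨Real.sqrt E, fun f hf => ?_⟩
  obtain ⟨c, hc, hc0, hc1⟩ := h.exists_flow hf
  obtain ⟨C, r, hr0, hr1, hCr⟩ := hc.decay
  have hs : Summable fun n => ‖c 1 n‖ ^ 2 * sqWeight ν n :=
    summable_sq_norm_of_geometric ν hr0 hr1 (hCr 1 ⟨zero_le_one, le_rfl⟩)
  refine ⟨S.ofCoeff (c 1) hs, fun z => (S.isTaylor_ofCoeff _ hs z).unique (hc1 z), ?_⟩
  obtain ⟨η, hη, hle⟩ := hc.energy_le hK0 hK h.norm_right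
  have h0 : ∀ M, energy ν M (c 0) ≤ ‖f‖ ^ 2 := fun M => by
    refine le_trans (le_of_eq ?_) (f.sum_le_norm_sq (Finset.range M))
    refine Finset.sum_congr rfl fun n _ => ?_
    rw [hc0, norm_mul, norm_pow, h.norm_left, one_pow, one_mul]
  have hsq : ‖S.ofCoeff (c 1) hs‖ ^ 2 ≤ E * (‖f‖ ^ 2 + 0) := by
    refine le_of_tendsto_of_tendsto
      (((S.ofCoeff (c 1) hs).hasSum_norm_sq.tendsto_sum_nat).comp (tendsto_add_atTop_nat 1))
      ((tendsto_const_nhds.add hη).const_mul E) (Eventually.of_forall fun M => ?_)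
    simp only [Function.comp_apply, S.coeff_ofCoeff]
    refine (hle M).trans ?_
    gcongr
    exact h0 _
  rw [add_zero] at hsq
  refine (sq_le_sq₀ (norm_nonneg _) (by positivity)).1 ?_
  rwa [mul_pow, Real.sq_sqrt hE]

theorem exists_compositionOperator (h : IsMoebius l a φ) (ν : ℝ) :
    ∃ T : S ν →L[ℂ] S ν, IsCompositionOperator φ T := by
  obtain ⟨B, hB⟩ := h.exists_bound ν
  set V := Submodule.span ℂ (Set.range (S.kernel ν))
  choose g hg hgB using fun f : V => hB f f.2
  let T₀ : V →ₗ[ℂ] S ν :=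
    { toFun := g
      map_add' := fun x y => S.ext_apply fun z => by
        rw [S.coe_add, hg, hg, hg]; rfl
      map_smul' := fun k x => S.ext_apply fun z => by
        rw [RingHom.id_apply, S.coe_smul, hg, hg]; rfl }
  let T₁ : V →L[ℂ] S ν := T₀.mkContinuous B hgB
  have hdense : DenseRange V.subtypeL := by
    rw [DenseRange, Submodule.coe_subtypeL, Submodule.coe_subtype, Subtype.range_coe]
    exact S.dense_span_kernel
  have hind : IsUniformInducing V.subtypeL := isUniformInducing_val _
  refine ⟨T₁.extend V.subtypeL, fun f z => ?_⟩
  -- Both sides of the composition identity are continuous in `f`, so agreement on the dense span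
  -- suffices.
  have h1 : Continuous fun f : S ν => (T₁.extend V.subtypeL f) z :=
    (S.continuous_eval z).comp (T₁.extend V.subtypeL).continuous
  refine congrFun (hdense.equalizer h1 (S.continuous_eval (φ z)) (funext fun x => ?_)) f
  simp only [Function.comp_apply]
  rw [ContinuousLinearMap.extend_eq _ hdense hind]
  exact hg x z

end IsMoebius

/-! ### Automorphisms of the disc and their dynamics -/

theorem sq_norm_add (x y : ℂ) : ‖x + y‖ ^ 2 = ‖x‖ ^ 2 + ‖y‖ ^ 2 + 2 * (x * conj y).re := by
  simp only [Complex.sq_norm, Complex.normSq_add]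

/-- The squared moduli are trigonometric polynomials of degree one; the points `1`, `-1` and `i`
determine their coefficients. -/
theorem eq_of_norm_eq_on_circle {α β γ δ : ℂ}
    (h : ∀ z : ℂ, ‖z‖ = 1 → ‖α * z + β‖ = ‖γ * z + δ‖) :
    ‖α‖ ^ 2 + ‖β‖ ^ 2 = ‖γ‖ ^ 2 + ‖δ‖ ^ 2 ∧ α * conj β = γ * conj δ := by
  have key : ∀ z : ℂ, ‖z‖ = 1 → ‖α‖ ^ 2 + ‖β‖ ^ 2 + 2 * (z * (α * conj β)).re
      = ‖γ‖ ^ 2 + ‖δ‖ ^ 2 + 2 * (z * (γ * conj δ)).re := fun z hz => by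
    have := congrArg (· ^ 2) (h z hz)
    simp only [sq_norm_add, norm_mul, hz, mul_one] at this
    rwa [show α * z * conj β = z * (α * conj β) by ring,
      show γ * z * conj δ = z * (γ * conj δ) by ring] at this
  have h1 := key 1 (by simp)
  have h2 := key (-1) (by simp)
  have h3 := key Complex.I (by simp)
  simp only [one_mul, neg_mul, Complex.neg_re, Complex.I_mul_re] at h1 h2 h3
  refine ⟨by linarith, Complex.ext (by linarith) (by linarith)⟩

/-! ### Normal form of a disc automorphism. -/

namespace IsAutomorphismBy

variable {g : GL (Fin 2) ℂ} {φ : 𝔻 → 𝔻}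

theorem denom_ne_zero (h : IsAutomorphismBy g φ) (z : 𝔻) : g 1 0 * (z : ℂ) + g 1 1 ≠ 0 := by
  intro h0
  have := h.2 z
  rw [OnePoint.smul_some_eq_ite, if_pos h0] at this
  exact OnePoint.infty_ne_coe _ this

theorem coe_apply (h : IsAutomorphismBy g φ) (z : 𝔻) :
    (φ z : ℂ) = (g 0 0 * (z : ℂ) + g 0 1) / (g 1 0 * (z : ℂ) + g 1 1) := by
  have := h.2 z
  rw [OnePoint.smul_some_eq_ite, if_neg (h.denom_ne_zero z)] at this
  exact (OnePoint.coe_injective this).symm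

theorem norm_num_lt (h : IsAutomorphismBy g φ) (z : 𝔻) :
    ‖g 0 0 * (z : ℂ) + g 0 1‖ < ‖g 1 0 * (z : ℂ) + g 1 1‖ := by
  have h1 := (φ z).norm_lt_one
  rwa [h.coe_apply, norm_div, div_lt_one (norm_pos_iff.2 (h.denom_ne_zero z))] at h1

theorem det_ne_zero (g : GL (Fin 2) ℂ) : g 0 0 * g 1 1 - g 0 1 * g 1 0 ≠ 0 := by
  have := g.det_ne_zero
  rwa [Matrix.det_fin_two] at this

/-- Continuity gives `≤`. If a circle point were sent into the disc, its image would by surjectivity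
also be the image of a disc point, against injectivity of the linear fractional map. -/
theorem norm_num_eq (h : IsAutomorphismBy g φ) {z : ℂ} (hz : ‖z‖ = 1) :
    ‖g 0 0 * z + g 0 1‖ = ‖g 1 0 * z + g 1 1‖ := by
  have hle : ‖g 0 0 * z + g 0 1‖ ≤ ‖g 1 0 * z + g 1 1‖ := by
    have hclosed : IsClosed {z : ℂ | ‖g 0 0 * z + g 0 1‖ ≤ ‖g 1 0 * z + g 1 1‖} :=
      isClosed_le (by fun_prop) (by fun_prop)
    have hsub : Metric.ball (0 : ℂ) 1 ⊆ {z : ℂ | ‖g 0 0 * z + g 0 1‖ ≤ ‖g 1 0 * z + g 1 1‖} :=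
      fun z hz => (h.norm_num_lt (Complex.UnitDisc.mk z (by simpa using hz))).le
    have := closure_minimal hsub hclosed
    rw [closure_ball _ one_ne_zero] at this
    exact this (by simp [hz])
  refine hle.antisymm (not_lt.1 fun hlt => ?_)
  have hne : g 1 0 * z + g 1 1 ≠ 0 := norm_pos_iff.1 ((norm_nonneg _).trans_lt hlt)
  have hw : ‖(g 0 0 * z + g 0 1) / (g 1 0 * z + g 1 1)‖ < 1 := by
    rwa [norm_div, div_lt_one (norm_pos_iff.2 hne)]
  obtain ⟨z', hz'⟩ := h.1.2 (Complex.UnitDisc.mk _ hw)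
  have h1 := congrArg Complex.UnitDisc.coe hz'
  rw [h.coe_apply, Complex.UnitDisc.coe_mk, div_eq_div_iff (h.denom_ne_zero z') hne] at h1
  have h2 : (g 0 0 * g 1 1 - g 0 1 * g 1 0) * ((z' : ℂ) - z) = 0 := by linear_combination h1
  have h3 : (z' : ℂ) = z :=
    sub_eq_zero.1 ((mul_eq_zero.1 h2).resolve_left (det_ne_zero g))
  have := z'.norm_lt_one
  rw [h3, hz] at this
  exact lt_irrefl _ this

theorem exists_isMoebius (h : IsAutomorphismBy g φ) :
    ∃ l a d : ℂ, IsMoebius l a φ ∧ d ≠ 0 ∧ g 0 0 = d * l ∧ g 0 1 = -(d * l * a) ∧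
      g 1 0 = -(d * conj a) ∧ g 1 1 = d := by
  obtain ⟨h1, h2⟩ := eq_of_norm_eq_on_circle fun z hz => h.norm_num_eq hz
  have h0 : ‖g 0 1‖ < ‖g 1 1‖ := by simpa using h.norm_num_lt 0
  have happ := h.coe_apply
  have hden := h.denom_ne_zero
  generalize g 0 0 = α at *
  generalize g 0 1 = β at *
  generalize g 1 0 = γ at *
  generalize g 1 1 = δ at *
  have h0' : ‖β‖ ^ 2 < ‖δ‖ ^ 2 := pow_lt_pow_left₀ h0 (norm_nonneg _) two_ne_zero
  have h3 : ‖α‖ ^ 2 * ‖β‖ ^ 2 = ‖γ‖ ^ 2 * ‖δ‖ ^ 2 := by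
    have := congrArg (fun x => ‖x‖ ^ 2) h2
    simpa [mul_pow] using this
  -- The pairs `|α|², |β|²` and `|γ|², |δ|²` have the same sum and product, so they agree up to
  -- order; `|β| < |δ|` selects `|α| = |δ|`.
  have h4 : (‖α‖ ^ 2 - ‖δ‖ ^ 2) * (‖α‖ ^ 2 - ‖γ‖ ^ 2) = 0 := by
    linear_combination ‖α‖ ^ 2 * h1 - h3
  have h5 : ‖α‖ ^ 2 = ‖δ‖ ^ 2 := by
    rcases mul_eq_zero.1 h4 with h | h
    · linarith
    · linarith
  have h6 : ‖α‖ = ‖δ‖ := (pow_left_inj₀ (norm_nonneg _) (norm_nonneg _) two_ne_zero).1 h5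
  have hδ : δ ≠ 0 := norm_pos_iff.1 ((norm_nonneg _).trans_lt h0)
  have hα : α ≠ 0 := norm_pos_iff.1 (by rw [h6]; exact norm_pos_iff.2 hδ)
  have hα' : conj α ≠ 0 := by simpa using hα
  have h7 : γ * conj α = δ * conj β := by
    have e1 : α * conj α = δ * conj δ := by
      rw [Complex.mul_conj', Complex.mul_conj', h6]
    refine mul_left_cancel₀ hα ?_
    linear_combination γ * e1 - δ * h2
  have hγ : γ = -(δ * conj (-β / α)) := by
    rw [map_div₀, map_neg]
    field_simp
    linear_combination h7
  refine ⟨α / δ, -β / α, δ, ⟨?_, ?_, fun z => ?_⟩, hδ, ?_, ?_, hγ, rfl⟩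
  · rw [norm_div, h6, div_self (norm_ne_zero_iff.2 hδ)]
  · rw [norm_div, norm_neg, div_lt_one (norm_pos_iff.2 hα), h6]
    exact h0
  · have hz := hden z
    rw [happ, div_mul_div_comm]
    congr 1
    · field_simp
      ring
    · conv_lhs => rw [hγ]
      ring
  · field_simp
  · field_simp

theorem pow (h : IsAutomorphismBy g φ) (k : ℕ) : IsAutomorphismBy (g ^ k) φ^[k] := by
  refine ⟨h.1.iterate k, ?_⟩
  induction k with
  | zero => intro z; simp
  | succ k ih =>
    intro z
    rw [pow_succ', mul_smul, ih, h.2, Function.iterate_succ_apply']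

theorem inv (h : IsAutomorphismBy g φ) {ψ : 𝔻 → 𝔻} (hl : Function.LeftInverse ψ φ)
    (hr : Function.RightInverse ψ φ) : IsAutomorphismBy g⁻¹ ψ := by
  refine ⟨⟨hr.injective, hl.surjective⟩, fun z => ?_⟩
  rw [inv_smul_eq_iff, h.2, hr z]

end IsAutomorphismBy

/-- A disc automorphism without fixed points in the disc, given by its two (possibly equal)
fixed points on the circle. -/
structure IsMoebiusWithFixedPoints (l a p q : ℂ) (φ : 𝔻 → 𝔻) : Prop where
  isMoebius : IsMoebius l a φ
  ne_zero : a ≠ 0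
  norm_fst : ‖p‖ = 1
  norm_snd : ‖q‖ = 1
  fixed_fst : l * (p - a) = p * (1 - conj a * p)
  fixed_snd : l * (q - a) = q * (1 - conj a * q)
  add_eq : conj a * (p + q) = 1 - l

/-! ### Convergence of iterates to a boundary fixed point. -/

namespace IsMoebiusWithFixedPoints

variable {l a p q : ℂ} {φ : 𝔻 → 𝔻}

theorem symm (h : IsMoebiusWithFixedPoints l a p q φ) : IsMoebiusWithFixedPoints l a q p φ :=
  ⟨h.isMoebius, h.ne_zero, h.norm_snd, h.norm_fst, h.fixed_snd, h.fixed_fst, by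
    rw [add_comm]; exact h.add_eq⟩

theorem coe_ne (h : IsMoebiusWithFixedPoints l a p q φ) (z : 𝔻) : (z : ℂ) - p ≠ 0 := by
  intro h0
  have := z.norm_lt_one
  rw [sub_eq_zero.1 h0, h.norm_fst] at this
  exact lt_irrefl _ this

theorem denom_ne_zero (h : IsMoebiusWithFixedPoints l a p q φ) : 1 - conj a * p ≠ 0 :=
  one_sub_conj_mul_ne_zero h.isMoebius.norm_right h.norm_fst.le

/-- The relation `add_eq` is Vieta's formula for the fixed point equation, which also records
multiplicity when `p = q`. Dividing the formulas for `p` and `q` gives a dilation of `(z - p) / (z -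
q)`; inverting it when `p = q` gives a translation of `1 / (z - p)`. -/
theorem apply_sub (h : IsMoebiusWithFixedPoints l a p q φ) (z : 𝔻) :
    (φ z : ℂ) - p = (1 - conj a * q) * ((z : ℂ) - p) / (1 - conj a * z) := by
  have hz := one_sub_conj_mul_ne_zero h.isMoebius.norm_right z.norm_lt_one.le
  rw [h.isMoebius.apply_eq, eq_div_iff hz, sub_mul, mul_assoc, div_mul_cancel₀ _ hz]
  linear_combination h.fixed_fst + ((z : ℂ) - p) * h.add_eq

theorem conj_denom (h : IsMoebiusWithFixedPoints l a p q φ) :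
    l * conj (1 - conj a * p) = 1 - conj a * p := by
  have hp : p * conj p = 1 := by rw [Complex.mul_conj', h.norm_fst]; simp
  have hp0 : p ≠ 0 := fun h0 => by simp [h0] at hp
  refine mul_left_cancel₀ hp0 ?_
  simp only [map_sub, map_one, map_mul, Complex.conj_conj]
  linear_combination h.fixed_fst - l * a * hp

theorem re_denom_pos (h : IsMoebiusWithFixedPoints l a p q φ) : 0 < (1 - conj a * p).re := by
  have h1 := (le_abs_self _).trans (Complex.abs_re_le_norm (conj a * p))
  rw [norm_mul, RCLike.norm_conj, h.norm_fst, mul_one] at h1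
  rw [Complex.sub_re, Complex.one_re]
  linarith [h.isMoebius.norm_right]

/-- By `conj_denom`, `x = 1 - ā p` and `y = 1 - ā q` satisfy `x² = l |x|²` and `y² = l |y|²`. Equal
moduli give `x = ± y`; positive real parts exclude the minus sign, and `p ≠ q` excludes the plus
sign. So the multiplier of the dilation is not of modulus one. -/
theorem norm_denom_ne (h : IsMoebiusWithFixedPoints l a p q φ) (hpq : p ≠ q) :
    ‖1 - conj a * p‖ ≠ ‖1 - conj a * q‖ := by
  intro heq
  have hx := h.conj_denom
  have hy := h.symm.conj_denom
  have hx0 := h.re_denom_pos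
  have hy0 := h.symm.re_denom_pos
  have hne : (1 - conj a * p) ≠ (1 - conj a * q) := fun h0 => by
    have : conj a * (p - q) = 0 := by linear_combination -h0
    rcases mul_eq_zero.1 this with h1 | h1
    · exact h.ne_zero (by simpa using h1)
    · exact hpq (sub_eq_zero.1 h1)
  generalize 1 - conj a * p = x at *
  generalize 1 - conj a * q = y at *
  have e1 : x * conj x = y * conj y := by rw [Complex.mul_conj', Complex.mul_conj', heq]
  have e2 : (x - y) * (x + y) = 0 := by
    linear_combination -x * hx + l * e1 + y * hy
  rcases mul_eq_zero.1 e2 with h1 | h1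
  · exact hne (sub_eq_zero.1 h1)
  · have := congrArg Complex.re h1
    simp at this
    linarith

theorem tendsto_of_eq (h : IsMoebiusWithFixedPoints l a p p φ) (z : 𝔻) :
    Tendsto (fun n => (φ^[n] z : ℂ)) atTop (𝓝 p) := by
  have hx := h.denom_ne_zero
  set c := conj a / (1 - conj a * p) with hc
  have hc0 : c ≠ 0 := div_ne_zero (by simpa using h.ne_zero) hx
  have hstep : ∀ z : 𝔻, ((φ z : ℂ) - p)⁻¹ = ((z : ℂ) - p)⁻¹ - c := fun z => by
    have hz := one_sub_conj_mul_ne_zero h.isMoebius.norm_right z.norm_lt_one.le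
    have hzp := h.coe_ne z
    rw [h.apply_sub, hc]
    field_simp
    ring
  have hiter : ∀ n : ℕ, ((φ^[n] z : ℂ) - p)⁻¹ = ((z : ℂ) - p)⁻¹ - n * c := fun n => by
    induction n with
    | zero => simp
    | succ n ih =>
      rw [Function.iterate_succ_apply', hstep, ih]
      push_cast
      ring
  have hcob : Tendsto (fun n : ℕ => ((z : ℂ) - p)⁻¹ - n * c) atTop (Bornology.cobounded ℂ) := by
    rw [← tendsto_norm_atTop_iff_cobounded]
    have h1 : Tendsto (fun n : ℕ => (n : ℝ) * ‖c‖ - ‖((z : ℂ) - p)⁻¹‖) atTop atTop :=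
      tendsto_atTop_add_const_right _ _
        (tendsto_natCast_atTop_atTop.atTop_mul_const (norm_pos_iff.2 hc0))
    refine tendsto_atTop_mono (fun n => ?_) h1
    have := norm_sub_norm_le ((n : ℂ) * c) ((z : ℂ) - p)⁻¹
    rw [norm_mul, Complex.norm_natCast] at this
    rwa [norm_sub_rev]
  have h2 := (tendsto_inv₀_cobounded (α := ℂ)).comp hcob
  have h3 := h2.add_const p
  rw [zero_add] at h3
  refine h3.congr fun n => ?_
  simp only [Function.comp_apply]
  rw [← hiter, inv_inv, sub_add_cancel]

theorem tendsto_of_norm_lt (h : IsMoebiusWithFixedPoints l a p q φ)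
    (hlt : ‖1 - conj a * q‖ < ‖1 - conj a * p‖) (z : 𝔻) :
    Tendsto (fun n => (φ^[n] z : ℂ)) atTop (𝓝 p) := by
  have hx := h.denom_ne_zero
  have hy := h.symm.denom_ne_zero
  set κ := (1 - conj a * q) / (1 - conj a * p) with hκ
  have hκ1 : ‖κ‖ < 1 := by rwa [hκ, norm_div, div_lt_one (norm_pos_iff.2 hx)]
  have hstep : ∀ z : 𝔻, ((φ z : ℂ) - p) / ((φ z : ℂ) - q)
      = κ * (((z : ℂ) - p) / ((z : ℂ) - q)) := fun z => by
    have hz := one_sub_conj_mul_ne_zero h.isMoebius.norm_right z.norm_lt_one.le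
    have hzp := h.symm.coe_ne z
    rw [h.apply_sub, h.symm.apply_sub, hκ]
    field_simp
  have hiter : ∀ n : ℕ, ((φ^[n] z : ℂ) - p) / ((φ^[n] z : ℂ) - q)
      = κ ^ n * (((z : ℂ) - p) / ((z : ℂ) - q)) := fun n => by
    induction n with
    | zero => simp
    | succ n ih =>
      rw [Function.iterate_succ_apply', hstep, ih]
      ring
  set X := ((z : ℂ) - p) / ((z : ℂ) - q) with hX
  have hbound : ∀ n : ℕ, ‖(φ^[n] z : ℂ) - p‖ ≤ ‖κ‖ ^ n * (‖X‖ * 2) := fun n => by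
    have h1 : (φ^[n] z : ℂ) - p = κ ^ n * X * ((φ^[n] z : ℂ) - q) := by
      rw [← hiter, div_mul_cancel₀ _ (h.symm.coe_ne _)]
    have h2 : ‖(φ^[n] z : ℂ) - q‖ ≤ 2 := by
      refine (norm_sub_le _ _).trans ?_
      rw [h.norm_snd]
      linarith [(φ^[n] z).norm_lt_one]
    rw [h1, norm_mul, norm_mul, norm_pow, mul_assoc]
    gcongr
  rw [tendsto_iff_norm_sub_tendsto_zero]
  refine squeeze_zero (fun n => norm_nonneg _) hbound ?_
  simpa using (tendsto_pow_atTop_nhds_zero_of_lt_one (norm_nonneg κ) hκ1).mul_const (‖X‖ * 2)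

theorem exists_tendsto (h : IsMoebiusWithFixedPoints l a p q φ) :
    ∃ p : ℂ, ‖p‖ = 1 ∧ ∀ z, Tendsto (fun n => (φ^[n] z : ℂ)) atTop (𝓝 p) := by
  by_cases hpq : p = q
  · subst hpq
    exact ⟨p, h.norm_fst, h.tendsto_of_eq⟩
  rcases (h.norm_denom_ne hpq).lt_or_gt with hlt | hlt
  · exact ⟨q, h.norm_snd, h.symm.tendsto_of_norm_lt hlt⟩
  · exact ⟨p, h.norm_fst, h.tendsto_of_norm_lt hlt⟩

end IsMoebiusWithFixedPoints

theorem smul_eq_self_iff {g : GL (Fin 2) ℂ} {l a d : ℂ} (ha : ‖a‖ < 1) (hl : l ≠ 0) (hd : d ≠ 0)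
    (h00 : g 0 0 = d * l) (h01 : g 0 1 = -(d * l * a)) (h10 : g 1 0 = -(d * conj a))
    (h11 : g 1 1 = d) (p : ℂ) :
    g • (p : OnePoint ℂ) = (p : OnePoint ℂ) ↔ l * (p - a) = p * (1 - conj a * p) := by
  have e1 : g 1 0 * p + g 1 1 = d * (1 - conj a * p) := by rw [h10, h11]; ring
  have e2 : g 0 0 * p + g 0 1 = d * (l * (p - a)) := by rw [h00, h01]; ring
  rw [OnePoint.smul_some_eq_ite, e1, e2]
  by_cases h0 : 1 - conj a * p = 0
  · rw [h0, mul_zero, if_pos rfl, mul_zero]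
    refine ⟨fun h => absurd h (OnePoint.infty_ne_coe _), fun h => ?_⟩
    have hpa : p = a := sub_eq_zero.1 ((mul_eq_zero.1 h).resolve_left hl)
    rw [hpa] at h0
    exact absurd h0 (one_sub_conj_mul_ne_zero ha ha.le)
  · rw [if_neg (mul_ne_zero hd h0), mul_div_mul_left _ _ hd, OnePoint.coe_eq_coe,
      div_eq_iff h0]

theorem exists_isAutomorphismBy {φ : 𝔻 → 𝔻}
    (h : IsParabolicAutomorphism φ ∨ IsHyperbolicAutomorphism φ) :
    ∃ g : GL (Fin 2) ℂ, IsAutomorphismBy g φ := by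
  rcases h with ⟨g, hg, -⟩ | ⟨g, hg, -⟩ <;> exact ⟨g, hg⟩

theorem exists_tendsto_iterate {φ : 𝔻 → 𝔻}
    (h : IsParabolicAutomorphism φ ∨ IsHyperbolicAutomorphism φ) :
    ∃ p : ℂ, ‖p‖ = 1 ∧ ∀ z, Tendsto (fun n => (φ^[n] z : ℂ)) atTop (𝓝 p) := by
  obtain ⟨g, hg, p, q, hp, hq, hfix⟩ : ∃ g : GL (Fin 2) ℂ, IsAutomorphismBy g φ ∧
      ∃ p q : ℂ, ‖p‖ = 1 ∧ ‖q‖ = 1 ∧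
        {w : OnePoint ℂ | g • w = w} = {(p : OnePoint ℂ), (q : OnePoint ℂ)} := by
    rcases h with ⟨g, hg, p, hp, hfix⟩ | ⟨g, hg, p, q, hp, hq, -, hfix⟩
    · exact ⟨g, hg, p, p, hp, hp, by simpa using hfix⟩
    · exact ⟨g, hg, p, q, hp, hq, hfix⟩
  obtain ⟨l, a, d, hm, hd, h00, h01, h10, h11⟩ := hg.exists_isMoebius
  have hl : l ≠ 0 := norm_pos_iff.1 (by rw [hm.norm_left]; exact one_pos)
  have hiff := smul_eq_self_iff hm.norm_right hl hd h00 h01 h10 h11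
  have hfp := (hiff p).1 (hfix.ge (Or.inl rfl))
  have hfq := (hiff q).1 (hfix.ge (Or.inr rfl))
  -- For `a = 0` the map is a rotation and fixes `∞`, which is not on the circle.
  have ha : a ≠ 0 := by
    rintro rfl
    have h1 : g • (OnePoint.infty : OnePoint ℂ) = OnePoint.infty := by
      rw [OnePoint.smul_infty_eq_self_iff, h10]; simp
    rcases hfix.le h1 with h2 | h2
    · exact OnePoint.infty_ne_coe _ h2
    · exact OnePoint.infty_ne_coe _ h2
  have ha' : conj a ≠ 0 := by simpa using ha
  refine IsMoebiusWithFixedPoints.exists_tendsto (l := l) (a := a) (p := p) (q := q)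
    ⟨hm, ha, hp, hq, hfp, hfq, ?_⟩
  by_cases heq : p = q
  · subst heq
    -- The second root of the fixed point equation, by Vieta; uniqueness of the fixed point makes it
    -- equal to `p`.
    set r := (1 - l) / conj a - p with hr
    have hsum : conj a * (p + r) = 1 - l := by rw [hr]; field_simp; ring
    have hfr : l * (r - a) = r * (1 - conj a * r) := by
      linear_combination hfp + (r - p) * hsum
    rcases hfix.le ((hiff r).2 hfr) with h2 | h2
    · rwa [OnePoint.coe_injective h2] at hsum
    · rwa [OnePoint.coe_injective h2] at hsum
  · refine mul_left_cancel₀ (sub_ne_zero.2 heq) ?_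
    linear_combination hfp - hfq

/-! ### Recurrence for `ν < 1 / 2` -/

theorem IsCompositionOperator.pow {ν : ℝ} {φ : 𝔻 → 𝔻} {T : S ν →L[ℂ] S ν}
    (h : IsCompositionOperator φ T) (n : ℕ) : IsCompositionOperator φ^[n] (T ^ n) := by
  induction n with
  | zero => intro f z; simp
  | succ n ih =>
    intro f z
    rw [pow_succ, mul_apply_eq_comp, ih, h, Function.iterate_succ_apply']

/-- The weight `(n + 1)^(2ν)` with `2ν < 1` is `o(n)`. This is where the strict inequality enters
the decay of the iterates. -/
theorem exists_sqWeight_le_linear {ν : ℝ} (hν : ν < 1 / 2) {ε : ℝ} (hε : 0 < ε) :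
    ∃ C : ℝ, 0 ≤ C ∧ ∀ n : ℕ, sqWeight ν n ≤ ε * (n + 1) + C := by
  have h1 : Tendsto (fun n : ℕ => ((n : ℝ) + 1) ^ (-(1 - 2 * ν))) atTop (𝓝 0) :=
    (tendsto_rpow_neg_atTop (by linarith)).comp
      (tendsto_atTop_add_const_right _ _ tendsto_natCast_atTop_atTop)
  obtain ⟨N, hN⟩ := eventually_atTop.1 (h1.eventually_lt_const hε)
  refine ⟨∑ n ∈ Finset.range N, sqWeight ν n,
    Finset.sum_nonneg fun n _ => (sqWeight_pos ν n).le, fun n => ?_⟩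
  have hpos : (0 : ℝ) < (n : ℝ) + 1 := by positivity
  rcases lt_or_ge n N with hn | hn
  · have := Finset.single_le_sum (f := fun n => sqWeight ν n)
      (fun i _ => (sqWeight_pos ν i).le) (Finset.mem_range.2 hn)
    have : 0 ≤ ε * ((n : ℝ) + 1) := by positivity
    linarith
  · have h2 : sqWeight ν n = ((n : ℝ) + 1) ^ (-(1 - 2 * ν)) * (n + 1) := by
      rw [sqWeight_eq]
      nth_rewrite 3 [← Real.rpow_one ((n : ℝ) + 1)]
      rw [← Real.rpow_add hpos]
      congr 1
      ring
    have h3 : 0 ≤ ∑ n ∈ Finset.range N, sqWeight ν n :=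
      Finset.sum_nonneg fun n _ => (sqWeight_pos ν n).le
    rw [h2]
    have := mul_le_mul_of_nonneg_right (hN n hn).le hpos.le
    linarith

theorem hasSum_add_one_mul_geometric {𝕜 : Type*} [RCLike 𝕜] {r : 𝕜} (hr : ‖r‖ < 1) :
    HasSum (fun n : ℕ => ((n : 𝕜) + 1) * r ^ n) (1 / (1 - r) ^ 2) := by
  simpa using hasSum_choose_mul_geometric_of_norm_lt_one 1 hr

theorem IsMoebius.apply_zero {l a : ℂ} {φ : 𝔻 → 𝔻} (h : IsMoebius l a φ) :
    (φ 0 : ℂ) = -(l * a) := by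
  simp [h.apply_eq]

theorem IsMoebius.norm_apply_zero {l a : ℂ} {φ : 𝔻 → 𝔻} (h : IsMoebius l a φ) :
    ‖(φ 0 : ℂ)‖ = ‖a‖ := by
  rw [h.apply_zero, norm_neg, norm_mul, h.norm_left, one_mul]

namespace IsMoebius

variable {l a : ℂ} {φ : 𝔻 → 𝔻} {ν : ℝ}

theorem coeff_comp_kernel (h : IsMoebius l a φ) {T : S ν →L[ℂ] S ν}
    (hT : IsCompositionOperator φ T) (w : 𝔻) :
    (T (S.kernel ν w)).coeff = moebiusCoeff a (l * w) :=
  S.coeff_eq_of_isTaylor fun z => by rw [hT]; exact h.isTaylor_kernel_comp w z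

theorem coeff_comp_vanishingKernel (h : IsMoebius l a φ) {T : S ν →L[ℂ] S ν}
    (hT : IsCompositionOperator φ T) (p : ℂ) (w : 𝔻) (n : ℕ) :
    (T (S.vanishingKernel ν p w)).coeff n
      = moebiusCoeff a (l * w) n - (1 - (w : ℂ) * p)⁻¹ * 0 ^ n := by
  have h0 : T (S.kernel ν 0) = S.kernel ν 0 := S.ext_apply fun z => by
    rw [hT, S.kernel_apply, S.kernel_apply]; simp
  rw [S.vanishingKernel, map_sub, map_smul, h0, S.coeff_sub, S.coeff_smul, S.coeff_kernel,
    h.coeff_comp_kernel hT, Complex.UnitDisc.coe_zero]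

theorem one_sub_sq_norm_le (h : IsMoebius l a φ) (w : 𝔻) :
    (1 - ‖a‖ ^ 2) * (1 - ‖(w : ℂ)‖)
      ≤ 4 * (1 - ‖(l * w + conj a) / (1 + l * w * a)‖ ^ 2) := by
  have hlw := h.norm_mul_lt_one w
  have ha := h.norm_right
  have hpos := norm_pos_iff.2 (one_add_mul_ne_zero ha hlw)
  rw [norm_div_sq ha hlw]
  have hle : ‖1 + l * (w : ℂ) * a‖ ≤ 2 := by
    refine (norm_add_le _ _).trans ?_
    rw [norm_one, norm_mul]
    nlinarith [norm_nonneg a, norm_nonneg (l * (w : ℂ))]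
  have hA : 0 ≤ 1 - ‖a‖ ^ 2 := by nlinarith [norm_nonneg a]
  have hw0 := norm_nonneg (w : ℂ)
  have hw1 := w.norm_lt_one
  have hnorm : ‖l * (w : ℂ)‖ = ‖(w : ℂ)‖ := by rw [norm_mul, h.norm_left, one_mul]
  rw [hnorm, sub_sub_cancel, mul_div_assoc', le_div_iff₀ (by positivity)]
  have h1 : ‖1 + l * (w : ℂ) * a‖ ^ 2 ≤ 4 := by nlinarith
  have h2 : 1 - ‖(w : ℂ)‖ ≤ 1 - ‖(w : ℂ)‖ ^ 2 := by nlinarith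
  calc (1 - ‖a‖ ^ 2) * (1 - ‖(w : ℂ)‖) * ‖1 + l * (w : ℂ) * a‖ ^ 2
      ≤ (1 - ‖a‖ ^ 2) * (1 - ‖(w : ℂ)‖ ^ 2) * 4 := by
        have : 0 ≤ 1 - ‖(w : ℂ)‖ ^ 2 := by nlinarith
        gcongr
    _ = _ := by ring

/-- Put `A = 1 - |a|²`, `m = 1 - |w|` and `r = |u|²`. The linear part of the weight contributes
about `ε A² / (1 - r)²`, bounded since `A / (1 - r) ≤ 4 / m`; the constant part gains a factor `A`,
which tends to zero along the iterates. -/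
theorem norm_sq_comp_vanishingKernel_le (h : IsMoebius l a φ) {T : S ν →L[ℂ] S ν}
    (hT : IsCompositionOperator φ T) {ε C : ℝ} (hε : 0 ≤ ε) (hC : 0 ≤ C)
    (hw : ∀ n : ℕ, sqWeight ν n ≤ ε * (n + 1) + C) (p : ℂ) (w : 𝔻) :
    ‖T (S.vanishingKernel ν p w)‖ ^ 2 ≤
      ‖(1 - (w : ℂ) * φ 0)⁻¹ - (1 - (w : ℂ) * p)⁻¹‖ ^ 2 * sqWeight ν 0
        + (32 / (1 - ‖(w : ℂ)‖) ^ 6 * ε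
          + 4 * C / (1 - ‖(w : ℂ)‖) ^ 5 * (1 - ‖a‖ ^ 2)) := by
  have ha := h.norm_right
  have hlw := h.norm_mul_lt_one w
  set u := (l * w + conj a) / (1 + l * w * a) with hu
  have hu1 : ‖u‖ < 1 := norm_div_lt_one ha hlw
  set m := 1 - ‖(w : ℂ)‖ with hm
  have hm0 : 0 < m := by linarith [w.norm_lt_one]
  set A := 1 - ‖a‖ ^ 2 with hA
  have hA0 : 0 ≤ A := by nlinarith [norm_nonneg a]
  set r := ‖u‖ ^ 2 with hr
  have hr0 : 0 ≤ r := by positivity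
  have hr1 : r < 1 := by nlinarith [norm_nonneg u]
  have hAr : A * m ≤ 4 * (1 - r) := h.one_sub_sq_norm_le w
  have hq : A / (1 - r) ≤ 4 / m := by
    rw [div_le_div_iff₀ (by linarith) hm0]; exact hAr
  have hq0 : 0 ≤ A / (1 - r) := div_nonneg hA0 (by linarith)
  refine S.norm_sq_le_of_sum_le fun M => ?_
  rw [Finset.sum_range_succ', add_comm]
  refine add_le_add (le_of_eq ?_) ?_
  · rw [h.coeff_comp_vanishingKernel hT, moebiusCoeff, h.apply_zero, pow_zero, mul_one]
    congr 4
    ring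
  have hnr : ‖r‖ < 1 := by rwa [Real.norm_of_nonneg hr0]
  have hterm : ∀ n : ℕ, ‖(T (S.vanishingKernel ν p w)).coeff (n + 1)‖ ^ 2 * sqWeight ν (n + 1)
      ≤ A ^ 2 / m ^ 4 * (2 * ε * ((n + 1) * r ^ n) + C * r ^ n) := fun n => by
    have h1 := norm_moebiusCoeff_succ_le ha hlw n
    rw [show ‖l * (w : ℂ)‖ = ‖(w : ℂ)‖ by rw [norm_mul, h.norm_left, one_mul], ← hu, ← hm,
      ← hA] at h1
    rw [h.coeff_comp_vanishingKernel hT, zero_pow n.succ_ne_zero, mul_zero, sub_zero]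
    have h2 : sqWeight ν (n + 1) ≤ 2 * ε * (n + 1) + C := by
      refine (hw (n + 1)).trans ?_
      push_cast
      nlinarith [mul_nonneg hε (Nat.cast_nonneg n : (0 : ℝ) ≤ n)]
    calc _ ≤ (A / m ^ 2 * ‖u‖ ^ n) ^ 2 * (2 * ε * (n + 1) + C) := by
          have := (sqWeight_pos ν (n + 1)).le
          gcongr
      _ = _ := by rw [hr]; field_simp; ring
  have hs := ((hasSum_add_one_mul_geometric hnr).mul_left (2 * ε)).add
    ((hasSum_geometric_of_lt_one hr0 hr1).mul_left C) |>.mul_left (A ^ 2 / m ^ 4)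
  calc _ ≤ ∑ n ∈ Finset.range M, A ^ 2 / m ^ 4 * (2 * ε * ((n + 1) * r ^ n) + C * r ^ n) :=
        Finset.sum_le_sum fun n _ => hterm n
    _ ≤ A ^ 2 / m ^ 4 * (2 * ε * (1 / (1 - r) ^ 2) + C * (1 - r)⁻¹) :=
        sum_le_hasSum _ (fun n _ => by positivity) hs
    _ = 2 * ε / m ^ 4 * (A / (1 - r)) ^ 2 + C * A / m ^ 4 * (A / (1 - r)) := by
        have : 1 - r ≠ 0 := by linarith
        field_simp
    _ ≤ 2 * ε / m ^ 4 * (4 / m) ^ 2 + C * A / m ^ 4 * (4 / m) := by gcongr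
    _ = _ := by field_simp; ring

end IsMoebius

theorem tendsto_pow_vanishingKernel {ν : ℝ} (hν : ν < 1 / 2) {φ : 𝔻 → 𝔻} {g : GL (Fin 2) ℂ}
    (hg : IsAutomorphismBy g φ) {T : S ν →L[ℂ] S ν} (hT : IsCompositionOperator φ T) {p : ℂ}
    (hp : ‖p‖ = 1) (hlim : Tendsto (fun n => (φ^[n] 0 : ℂ)) atTop (𝓝 p)) (w : 𝔻) :
    Tendsto (fun n => (T ^ n) (S.vanishingKernel ν p w)) atTop (𝓝 0) := by
  rw [tendsto_zero_iff_norm_tendsto_zero]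
  suffices h : Tendsto (fun n => ‖(T ^ n) (S.vanishingKernel ν p w)‖ ^ 2) atTop (𝓝 0) by
    simpa using h.sqrt
  have hm0 : 0 < 1 - ‖(w : ℂ)‖ := by linarith [w.norm_lt_one]
  have hne : 1 - (w : ℂ) * p ≠ 0 := fun h0 => by
    have h1 : ‖(w : ℂ) * p‖ = 1 := by rw [← sub_eq_zero.1 h0, norm_one]
    rw [norm_mul, hp, mul_one] at h1
    exact w.norm_ne_one h1
  have h1 : Tendsto (fun n => ‖(1 - (w : ℂ) * φ^[n] 0)⁻¹ - (1 - (w : ℂ) * p)⁻¹‖ ^ 2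
      * sqWeight ν 0) atTop (𝓝 0) := by
    have := (((((hlim.const_mul (w : ℂ)).const_sub 1).inv₀ hne).sub_const
      (1 - (w : ℂ) * p)⁻¹).norm.pow 2).mul_const (sqWeight ν 0)
    simpa using this
  have h2 : Tendsto (fun n => 1 - ‖(φ^[n] 0 : ℂ)‖ ^ 2) atTop (𝓝 0) := by
    simpa [hp] using (hlim.norm.pow 2).const_sub 1
  rw [Metric.tendsto_atTop']
  intro η hη
  set m := 1 - ‖(w : ℂ)‖
  -- With this slope the term `32 ε / m⁶` equals `η / 4`; the remaining terms are eventually below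
  -- `η / 2`.
  have hε : 0 < η / 4 * (m ^ 6 / 32) := by positivity
  obtain ⟨C, hC, hCw⟩ := exists_sqWeight_le_linear hν hε
  have h3 := h1.add (h2.const_mul (4 * C / m ^ 5))
  rw [mul_zero, add_zero] at h3
  obtain ⟨N, hN⟩ := eventually_atTop.1 (h3.eventually_lt_const (half_pos hη))
  refine ⟨N, fun n hn => ?_⟩
  obtain ⟨l, a, d, hm, -⟩ := (hg.pow n).exists_isMoebius
  have h4 := hm.norm_sq_comp_vanishingKernel_le (hT.pow n) hε.le hC hCw p w
  have h5 := hN n hn.le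
  rw [hm.norm_apply_zero] at h5
  rw [Real.dist_eq, sub_zero, abs_of_nonneg (sq_nonneg _)]
  have h6 : 32 / m ^ 6 * (η / 4 * (m ^ 6 / 32)) = η / 4 := by field_simp
  rw [h6] at h4
  linarith

theorem exists_dense_tendsto_zero {ν : ℝ} (hν : ν < 1 / 2) {φ : 𝔻 → 𝔻}
    (hφ : IsParabolicAutomorphism φ ∨ IsHyperbolicAutomorphism φ) {T : S ν →L[ℂ] S ν}
    (hT : IsCompositionOperator φ T) :
    ∃ V : Set (S ν), Dense V ∧ ∀ f ∈ V, Tendsto (fun n => (T ^ n) f) atTop (𝓝 0) := by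
  obtain ⟨g, hg⟩ := exists_isAutomorphismBy hφ
  obtain ⟨p, hp, hlim⟩ := exists_tendsto_iterate hφ
  refine ⟨_, S.dense_span_vanishingKernel hν.le hp, fun f hf => ?_⟩
  induction hf using Submodule.span_induction with
  | mem f hf =>
    obtain ⟨w, rfl⟩ := hf
    exact tendsto_pow_vanishingKernel hν hg hT hp (hlim 0) w
  | zero => simp
  | add f g _ _ ihf ihg => simpa using ihf.add ihg
  | smul k f _ ihf => simpa using ihf.const_smul k

/-- An operator with a right inverse is recurrent if its powers, and the powers of the right
inverse, tend to zero pointwise on dense sets. -/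
theorem isRecurrent_of_dense {X : Type*} [NormedAddCommGroup X] [NormedSpace ℂ X]
    {T R : X →L[ℂ] X} (hTR : T * R = 1) {V W : Set X} (hV : Dense V) (hW : Dense W)
    (hTV : ∀ x ∈ V, Tendsto (fun n => (T ^ n) x) atTop (𝓝 0))
    (hRW : ∀ x ∈ W, Tendsto (fun n => (R ^ n) x) atTop (𝓝 0)) : IsRecurrent T := by
  intro U hU hne
  obtain ⟨x, hxU, hxV⟩ := hV.inter_open_nonempty U hU hne
  obtain ⟨y, hyU, hyW⟩ := hW.inter_open_nonempty U hU hne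
  have hpow : ∀ n, T ^ n * R ^ n = 1 := fun n => by
    induction n with
    | zero => simp
    | succ n ih => rw [pow_succ, pow_succ', mul_assoc, ← mul_assoc T, hTR, one_mul, ih]
  -- The point `x + Rⁿ y` is near `x`, and `Tⁿ` sends it to `Tⁿ x + y`, near `y`; both `x` and `y`
  -- lie in `U`.
  have h1 : Tendsto (fun n => x + (R ^ n) y) atTop (𝓝 x) := by
    simpa using (hRW y hyW).const_add x
  have h2 : Tendsto (fun n => (T ^ n) (x + (R ^ n) y)) atTop (𝓝 y) := by
    have : ∀ n, (T ^ n) (x + (R ^ n) y) = (T ^ n) x + y := fun n => by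
      rw [map_add, ← mul_apply_eq_comp, hpow, one_apply_eq_self]
    simp_rw [this]
    simpa using (hTV x hxV).add_const y
  obtain ⟨n, ⟨hn1, hn2⟩, hn⟩ := ((h1.eventually (hU.mem_nhds hxU)).and
    (h2.eventually (hU.mem_nhds hyU))).and (eventually_ge_atTop 1) |>.exists
  exact ⟨n, hn, _, hn1, hn2⟩

theorem isRecurrent_of_lt {ν : ℝ} (hν : ν < 1 / 2) {φ : 𝔻 → 𝔻}
    (hφ : IsParabolicAutomorphism φ ∨ IsHyperbolicAutomorphism φ) {T : S ν →L[ℂ] S ν}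
    (hT : IsCompositionOperator φ T) : IsRecurrent T := by
  obtain ⟨g₀, hg₀⟩ := exists_isAutomorphismBy hφ
  obtain ⟨ψ, hl, hr⟩ := Function.bijective_iff_has_inverse.1 hg₀.1
  -- A map and its inverse have the same fixed points, so the inverse automorphism is of the same
  -- type.
  have hinv : ∀ g : GL (Fin 2) ℂ,
      {w : OnePoint ℂ | g⁻¹ • w = w} = {w : OnePoint ℂ | g • w = w} := fun g => by
    ext w
    simp only [Set.mem_ofPred_eq, inv_smul_eq_iff]
    exact eq_comm
  have hψ : IsParabolicAutomorphism ψ ∨ IsHyperbolicAutomorphism ψ := by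
    rcases hφ with ⟨g, hg, p, hp, hfix⟩ | ⟨g, hg, p, q, hp, hq, hpq, hfix⟩
    · exact Or.inl ⟨g⁻¹, hg.inv hl hr, p, hp, (hinv g).trans hfix⟩
    · exact Or.inr ⟨g⁻¹, hg.inv hl hr, p, q, hp, hq, hpq, (hinv g).trans hfix⟩
  obtain ⟨g, hg⟩ := exists_isAutomorphismBy hψ
  obtain ⟨l, a, d, hm, -⟩ := hg.exists_isMoebius
  obtain ⟨R, hR⟩ := hm.exists_compositionOperator ν
  obtain ⟨V, hV, hTV⟩ := exists_dense_tendsto_zero hν hφ hT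
  obtain ⟨W, hW, hRW⟩ := exists_dense_tendsto_zero hν hψ hR
  refine isRecurrent_of_dense (R := R) ?_ hV hW hTV hRW
  ext f
  refine S.ext_apply fun z => ?_
  rw [mul_apply_eq_comp, hT, hR, hl, one_apply_eq_self]

/-! ### Failure of recurrence for `ν ≥ 1 / 2` -/

theorem le_sqWeight {ν : ℝ} (hν : 1 / 2 ≤ ν) (n : ℕ) : (n : ℝ) + 1 ≤ sqWeight ν n := by
  rw [sqWeight_eq]
  refine (Real.rpow_one _).symm.le.trans (Real.rpow_le_rpow_of_exponent_le ?_ (by linarith))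
  linarith [(Nat.cast_nonneg n : (0 : ℝ) ≤ n)]

namespace S

variable {ν : ℝ}

theorem norm_coeff_le (f : S ν) (n : ℕ) : ‖f.coeff n‖ ≤ (Real.sqrt (sqWeight ν n))⁻¹ * ‖f‖ := by
  have h := f.sum_le_norm_sq {n}
  rw [Finset.sum_singleton] at h
  have hw := sqWeight_pos ν n
  rw [← div_eq_inv_mul, le_div_iff₀ (Real.sqrt_pos.2 hw)]
  refine (sq_le_sq₀ (by positivity) (norm_nonneg _)).1 ?_
  rwa [mul_pow, Real.sq_sqrt hw.le]

theorem continuous_coeff (n : ℕ) : Continuous fun f : S ν => f.coeff n := by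
  let L : S ν →ₗ[ℂ] ℂ :=
    { toFun := fun f => f.coeff n
      map_add' := fun f g => coeff_add f g n
      map_smul' := fun c f => coeff_smul c f n }
  exact AddMonoidHomClass.continuous_of_bound L _ fun f => f.norm_coeff_le n

/-- The identity function `z ↦ z`. -/
def identity (ν : ℝ) : S ν :=
  ofCoeff (Pi.single 1 1) (summable_of_ne_finset_zero (s := {1}) fun n hn => by
    rw [Pi.single_eq_of_ne (by simpa using hn)]; simp)

theorem coeff_identity : (identity ν).coeff = Pi.single 1 1 := coeff_ofCoeff _ _

end S

/-- The Taylor coefficients of the element representing `f ↦ c f'(b)`. -/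
def derivCoeff (ν : ℝ) (c b : ℂ) (n : ℕ) : ℂ :=
  conj (c * (n * b ^ (n - 1))) * ((sqWeight ν n)⁻¹ : ℝ)

theorem norm_sq_derivCoeff (ν : ℝ) (c b : ℂ) (n : ℕ) :
    ‖derivCoeff ν c b n‖ ^ 2 * sqWeight ν n
      = ‖c‖ ^ 2 * ((n : ℝ) ^ 2 * (‖b‖ ^ 2) ^ (n - 1) * (sqWeight ν n)⁻¹) := by
  have hw := sqWeight_pos ν n
  rw [derivCoeff, norm_mul, RCLike.norm_conj, norm_mul, norm_mul, norm_pow, Complex.norm_real,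
    Complex.norm_natCast, Real.norm_of_nonneg (inv_nonneg.2 hw.le), ← pow_mul, mul_comm 2 (n - 1),
    pow_mul]
  field_simp

/-- Since `β_n² ≥ n + 1` for `ν ≥ 1/2`, one factor of the squared index is absorbed; the remaining
series sums to `1 / (1 - |b|²)²`. -/
theorem norm_sq_derivCoeff_succ_le {ν : ℝ} (hν : 1 / 2 ≤ ν) (c b : ℂ) (n : ℕ) :
    ‖derivCoeff ν c b (n + 1)‖ ^ 2 * sqWeight ν (n + 1)
      ≤ ‖c‖ ^ 2 * (((n : ℝ) + 1) * (‖b‖ ^ 2) ^ n) := by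
  rw [norm_sq_derivCoeff, Nat.add_sub_cancel]
  have h1 := le_sqWeight hν (n + 1)
  have hw := sqWeight_pos ν (n + 1)
  refine mul_le_mul_of_nonneg_left ?_ (sq_nonneg _)
  push_cast at h1 ⊢
  rw [← div_eq_mul_inv, div_le_iff₀ hw]
  have h2 : (0 : ℝ) ≤ ((n : ℝ) + 1) * (‖b‖ ^ 2) ^ n := by positivity
  nlinarith

theorem summable_derivCoeff {ν : ℝ} (hν : 1 / 2 ≤ ν) (c : ℂ) {b : ℂ} (hb : ‖b‖ < 1) :
    Summable fun n => ‖derivCoeff ν c b n‖ ^ 2 * sqWeight ν n := by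
  have hb2 : ‖‖b‖ ^ 2‖ < 1 := by
    rw [Real.norm_of_nonneg (sq_nonneg _)]; nlinarith [norm_nonneg b]
  rw [← summable_nat_add_iff 1]
  exact Summable.of_nonneg_of_le
    (fun n => mul_nonneg (sq_nonneg _) (sqWeight_pos ν _).le)
    (fun n => norm_sq_derivCoeff_succ_le hν c b n)
    ((hasSum_add_one_mul_geometric hb2).summable.mul_left _)

/-- The element of `S_ν` representing the functional `f ↦ c f'(b)`. -/
def derivVector {ν : ℝ} (hν : 1 / 2 ≤ ν) (c : ℂ) {b : ℂ} (hb : ‖b‖ < 1) : S ν :=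
  S.ofCoeff (derivCoeff ν c b) (summable_derivCoeff hν c hb)

section

variable {ν : ℝ} (hν : 1 / 2 ≤ ν) (c : ℂ) {b : ℂ} (hb : ‖b‖ < 1)

theorem norm_sq_derivVector_le :
    ‖derivVector hν c hb‖ ^ 2 ≤ ‖c‖ ^ 2 * (1 / (1 - ‖b‖ ^ 2) ^ 2) := by
  have hb2 : ‖‖b‖ ^ 2‖ < 1 := by
    rw [Real.norm_of_nonneg (sq_nonneg _)]; nlinarith [norm_nonneg b]
  refine S.norm_sq_le_of_sum_le fun M => ?_
  rw [derivVector, S.coeff_ofCoeff, Finset.sum_range_succ', norm_sq_derivCoeff _ _ _ 0]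
  simp only [CharP.cast_eq_zero, ne_eq, OfNat.ofNat_ne_zero, not_false_eq_true, zero_pow, zero_mul,
    mul_zero, add_zero]
  exact (Finset.sum_le_sum fun n _ => norm_sq_derivCoeff_succ_le hν c b n).trans
    (sum_le_hasSum _ (fun n _ => by positivity)
      ((hasSum_add_one_mul_geometric hb2).mul_left (‖c‖ ^ 2)))

theorem inner_derivVector (f : S ν) :
    inner ℂ (derivVector hν c hb) f = ∑' n, c * (n * b ^ (n - 1)) * f.coeff n := by
  rw [S.inner_eq, derivVector, S.coeff_ofCoeff]
  refine tsum_congr fun n => ?_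
  have : ((sqWeight ν n : ℝ) : ℂ) ≠ 0 := Complex.ofReal_ne_zero.2 (sqWeight_pos ν n).ne'
  rw [derivCoeff, map_mul, Complex.conj_conj, Complex.conj_ofReal]
  push_cast
  field_simp

theorem inner_derivVector_identity : inner ℂ (derivVector hν c hb) (S.identity ν) = c := by
  rw [inner_derivVector, S.coeff_identity, tsum_eq_single 1]
  · simp
  · intro n hn
    simp [hn]

theorem inner_derivVector_kernel (w : 𝔻) :
    inner ℂ (derivVector hν c hb) (S.kernel ν w) = c * w / (1 - b * w) ^ 2 := by
  have hbw : ‖b * (w : ℂ)‖ < 1 := by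
    rw [norm_mul]
    exact mul_lt_one_of_nonneg_of_lt_one_left (norm_nonneg _) hb w.norm_lt_one.le
  rw [inner_derivVector]
  refine HasSum.tsum_eq ?_
  rw [← hasSum_nat_add_iff' 1]
  have h := (hasSum_add_one_mul_geometric hbw).mul_left (c * w)
  rw [mul_one_div] at h
  simp only [S.coeff_kernel, Finset.sum_range_one, CharP.cast_eq_zero, zero_mul, mul_zero, sub_zero,
    Nat.add_sub_cancel]
  refine h.congr_fun fun n => ?_
  push_cast
  ring

end

/-- The derivative at the origin of a composition with a disc automorphism. -/
theorem IsMoebius.coeff_one_comp {ν : ℝ} (hν : 1 / 2 ≤ ν) {l a : ℂ} {φ : 𝔻 → 𝔻}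
    (h : IsMoebius l a φ) {T : S ν →L[ℂ] S ν} (hT : IsCompositionOperator φ T) (f : S ν) :
    (T f).coeff 1
      = inner ℂ (derivVector hν (l * (1 - a * conj a)) (φ 0).norm_lt_one) f := by
  set G := derivVector hν (l * (1 - a * conj a)) (φ 0).norm_lt_one
  have hspan : ∀ f ∈ Submodule.span ℂ (Set.range (S.kernel ν)),
      (T f).coeff 1 = inner ℂ G f := fun f hf => by
    induction hf using Submodule.span_induction with
    | mem f hf =>
      obtain ⟨w, rfl⟩ := hf
      rw [h.coeff_comp_kernel hT, inner_derivVector_kernel, moebiusCoeff, h.apply_zero]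
      ring
    | zero => rw [map_zero, S.coeff_zero, inner_zero_right]
    | add f g _ _ ihf ihg => rw [map_add, S.coeff_add, inner_add_right, ihf, ihg]
    | smul k f _ ihf => rw [map_smul, S.coeff_smul, inner_smul_right, ihf]
  have hcl : IsClosed {f : S ν | (T f).coeff 1 = inner ℂ G f} :=
    isClosed_eq ((S.continuous_coeff 1).comp T.continuous) (by fun_prop)
  exact (closure_minimal hspan hcl) (S.dense_span_kernel f)

/-- The chain rule factor has modulus `1 - |φ(0)|²`, exactly offsetting the bound on evaluating a
derivative at `φ(0)`. The resulting constant `1` is the same for all automorphisms, hence for all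
iterates. -/
theorem IsMoebius.norm_coeff_one_comp_le {ν : ℝ} (hν : 1 / 2 ≤ ν) {l a : ℂ} {φ : 𝔻 → 𝔻}
    (h : IsMoebius l a φ) {T : S ν →L[ℂ] S ν} (hT : IsCompositionOperator φ T) (f : S ν) :
    ‖(T f).coeff 1‖ ≤ ‖f‖ := by
  rw [h.coeff_one_comp hν hT]
  refine (norm_inner_le_norm _ _).trans (mul_le_of_le_one_left (norm_nonneg _) ?_)
  refine (sq_le_one_iff₀ (norm_nonneg _)).1 ((norm_sq_derivVector_le _ _ _).trans (le_of_eq ?_))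
  have : 1 - ‖a‖ ^ 2 ≠ 0 := by nlinarith [norm_nonneg a, h.norm_right]
  rw [norm_mul, h.norm_left, one_mul, norm_one_sub_mul_conj h.norm_right, h.norm_apply_zero]
  field_simp

theorem IsMoebius.norm_coeff_one_comp_identity {ν : ℝ} (hν : 1 / 2 ≤ ν) {l a : ℂ} {φ : 𝔻 → 𝔻}
    (h : IsMoebius l a φ) {T : S ν →L[ℂ] S ν} (hT : IsCompositionOperator φ T) :
    ‖(T (S.identity ν)).coeff 1‖ = 1 - ‖(φ 0 : ℂ)‖ ^ 2 := by
  rw [h.coeff_one_comp hν hT, inner_derivVector_identity, norm_mul, h.norm_left, one_mul,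
    norm_one_sub_mul_conj h.norm_right, h.norm_apply_zero]

theorem exists_le_sq_norm_iterate {φ : 𝔻 → 𝔻} {p : ℂ} (hp : ‖p‖ = 1)
    (hlim : Tendsto (fun n => (φ^[n] 0 : ℂ)) atTop (𝓝 p)) :
    ∃ δ : ℝ, 0 < δ ∧ ∀ k : ℕ, 1 ≤ k → δ ≤ ‖(φ^[k] 0 : ℂ)‖ ^ 2 := by
  have hn : Tendsto (fun n => ‖(φ^[n] 0 : ℂ)‖ ^ 2) atTop (𝓝 1) := by
    simpa [hp] using hlim.norm.pow 2
  obtain ⟨N, hN⟩ := eventually_atTop.1 (hn.eventually_const_lt (show (1 / 2 : ℝ) < 1 by norm_num))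
  have hne : ∀ k : ℕ, 1 ≤ k → 0 < ‖(φ^[k] 0 : ℂ)‖ ^ 2 := fun k hk => by
    refine pow_pos (norm_pos_iff.2 fun h0 => ?_) 2
    have hfix : Function.IsFixedPt φ^[k] 0 := Complex.UnitDisc.coe_eq_zero.1 h0
    -- If `φ^k` fixed `0`, the orbit would return to `0` at the time `k N ≥ N`, where the squared
    -- modulus already exceeds `1/2`.
    have h1 := hN (k * N) (Nat.le_mul_of_pos_left N hk)
    rw [Function.iterate_mul, hfix.iterate N] at h1
    norm_num at h1
  have hfin : ∀ M : ℕ, ∃ δ : ℝ, 0 < δ ∧ ∀ k : ℕ, 1 ≤ k → k < M → δ ≤ ‖(φ^[k] 0 : ℂ)‖ ^ 2 := by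
    intro M
    induction M with
    | zero => exact ⟨1, one_pos, fun k _ hk => absurd hk (Nat.not_lt_zero k)⟩
    | succ M ih =>
      obtain ⟨δ, hδ, h⟩ := ih
      rcases Nat.eq_zero_or_pos M with rfl | hM
      · exact ⟨1, one_pos, fun k hk hk' => by omega⟩
      refine ⟨min δ (‖(φ^[M] 0 : ℂ)‖ ^ 2), lt_min hδ (hne M hM), fun k hk hk' => ?_⟩
      rcases Nat.lt_succ_iff_lt_or_eq.1 hk' with h1 | rfl
      · exact (min_le_left _ _).trans (h k hk h1)
      · exact min_le_right _ _
  obtain ⟨δ, hδ, h⟩ := hfin N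
  refine ⟨min δ (1 / 2), lt_min hδ (by norm_num), fun k hk => ?_⟩
  rcases lt_or_ge k N with h1 | h1
  · exact (min_le_left _ _).trans (h k hk h1)
  · exact (min_le_right _ _).trans (hN k h1).le

theorem not_isRecurrent_of_le {ν : ℝ} (hν : 1 / 2 ≤ ν) {φ : 𝔻 → 𝔻}
    (hφ : IsParabolicAutomorphism φ ∨ IsHyperbolicAutomorphism φ) {T : S ν →L[ℂ] S ν}
    (hT : IsCompositionOperator φ T) : ¬ IsRecurrent T := by
  intro hrec
  obtain ⟨g, hg⟩ := exists_isAutomorphismBy hφ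
  obtain ⟨p, hp, hlim⟩ := exists_tendsto_iterate hφ
  obtain ⟨δ, hδ, hle⟩ := exists_le_sq_norm_iterate hp (hlim 0)
  obtain ⟨k, hk, f, hf, hTf⟩ := hrec (Metric.ball (S.identity ν) (δ / 2)) Metric.isOpen_ball
    (Metric.nonempty_ball.2 (half_pos hδ))
  rw [mem_ball_iff_norm] at hf
  rw [Set.mem_preimage, mem_ball_iff_norm] at hTf
  obtain ⟨l, a, d, hm, -⟩ := (hg.pow k).exists_isMoebius
  have hTk := hT.pow k
  have h1 : ‖((T ^ k) (f - S.identity ν)).coeff 1‖ < δ / 2 :=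
    (hm.norm_coeff_one_comp_le hν hTk _).trans_lt hf
  have h2 : ‖((T ^ k) f - S.identity ν).coeff 1‖ < δ / 2 := by
    refine (S.norm_coeff_le _ 1).trans_lt (lt_of_le_of_lt ?_ hTf)
    refine mul_le_of_le_one_left (norm_nonneg _) (inv_le_one_of_one_le₀ ?_)
    rw [Real.one_le_sqrt]
    refine le_trans ?_ (le_sqWeight hν 1)
    norm_num
  have h3 := hm.norm_coeff_one_comp_identity hν hTk
  rw [map_sub, S.coeff_sub] at h1
  rw [S.coeff_sub, S.coeff_identity, Pi.single_eq_same] at h2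
  set x := ((T ^ k) f).coeff 1
  set y := ((T ^ k) (S.identity ν)).coeff 1
  -- The three terms are less than `δ / 2`, less than `δ / 2` and at most `1 - δ`, a contradiction.
  have h4 : (1 : ℝ) ≤ ‖x - 1‖ + ‖x - y‖ + ‖y‖ := by
    calc (1 : ℝ) = ‖-(x - 1) + (x - y) + y‖ := by
          rw [show -(x - 1) + (x - y) + y = 1 by ring, norm_one]
      _ ≤ ‖-(x - 1)‖ + ‖x - y‖ + ‖y‖ := norm_add₃_le
      _ = _ := by rw [norm_neg]
  linarith [hle k hk]

end WeightedDirichlet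

end

theorem mainTheorem2 (φ : 𝔻 → 𝔻)
    (hφ : WeightedDirichlet.IsParabolicAutomorphism φ ∨
      WeightedDirichlet.IsHyperbolicAutomorphism φ) (ν : ℝ) :
    ∃ C : WeightedDirichlet.S ν →L[ℂ] WeightedDirichlet.S ν,
      WeightedDirichlet.IsCompositionOperator φ C ∧
        (WeightedDirichlet.IsRecurrent C ↔ ν < 1 / 2) := by
  obtain ⟨g, hg⟩ := WeightedDirichlet.exists_isAutomorphismBy hφ
  obtain ⟨l, a, d, hm, -⟩ := hg.exists_isMoebius
  obtain ⟨C, hC⟩ := hm.exists_compositionOperator ν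
  refine ⟨C, hC, fun hrec => ?_, fun hν => WeightedDirichlet.isRecurrent_of_lt hν hφ hC⟩
  by_contra hν
  exact WeightedDirichlet.not_isRecurrent_of_le (not_lt.1 hν) hφ hC hrec
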